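/- Let $k$ be a field of characteristic zero and let $\mathrm{OT}$ be the set of planar rooted trees. Let $\mathfrak g_F$ be the free post-Lie algebra on one generator, that is, the free Lie algebra over $k$ on the set $\mathrm{OT}$ with the unique post-Lie product $\triangleright$ (a bilinear product with $x\triangleright[y,z]=[x\triangleright y,z]+[y,x\triangleright z]$ and $[x,y]\triangleright z=x\triangleright(y\triangleright z)-(x\triangleright y)\triangleright z-y\triangleright(x\triangleright z)+(y\triangleright x)\triangleright z$) for which $\tau_1\triangleright\tau_2$, for trees $\tau_1,\tau_2$, is the sum of all trees obtained by attaching the root of $\tau_1$ from the left to a vertex of $\tau_2$ (left grafting). Let $\mathcal U(\mathfrak g_F)$ be its universal enveloping algebra, which has the ordered forests (words in $\mathrm{OT}$, including the empty word) as a basis, with the coproduct $\Delta(A)=\sum A_{(1)}\otimes A_{(2)}$ that is the algebra morphism with $\Delta(x)=x\otimes 1+1\otimes x$ for $x\in\mathfrak g_F$. Extend $\triangleright$ to $\mathcal U(\mathfrak g_F)$ as the unique bilinear product that agrees with $\triangleright$ on $\mathfrak g_F$ and satisfies $$1\triangleright A=A,\qquad xA\triangleright y=x\triangleright(A\triangleright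 y)-(x\triangleright A)\triangleright y,\qquad A\triangleright BC=\sum(A_{(1)}\triangleright B)(A_{(2)}\triangleright C)$$ for $A,B,C\in\mathcal U(\mathfrak g_F)$ and $x,y\in\mathfrak g_F$, and put $A*B=\sum A_{(1)}(A_{(2)}\triangleright B)$. On the other hand, define the left grafting of an ordered forest $\omega=\tau_1\cdots\tau_n$ to an ordered forest $\nu$ as the sum of all ordered forests obtained by grafting $\tau_n$ from the left to a vertex of $\nu$, then $\tau_{n-1}$ from the left to a vertex not originally from $\tau_n$, and so on, so that each $\tau_i$ is attached to a vertex of $\nu$. Let $B^+$ be the linear map that sends an ordered forest to the tree obtained by joining its trees to a new root, and $B^-$ its inverse, from the span of the trees, which removes the root. The planar Grossman–Larson product is the bilinear product on $\mathcal U(\mathfrak g_F)$ given on ordered forests by $\omega_1\circ\omega_2=B^-(\omega_1\triangleright B^+(\omega_2))$, where $\triangleright$ is left grafting of forests. Then the extended product $\omega\triangleright\nu$ of any ordered forests $\omega,\nu$ is the left grafting of $\omega$ to $\nu$, and $A*B=A\circ B$ for all $A,B\in\mathcal U(\mathfrak g_F)$. -/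

import Mathlib

open scoped TensorProduct

noncomputable section

namespace PostLie

section Filtration

variable {R M A : Type*} [CommRing R] [AddCommGroup M] [Module R M] [Ring A] [Algebra R A]

/-- The span of the products of at most `n` elements of the range of `j`. -/
def wordFiltration (j : M →ₗ[R] A) (n : ℕ) : Submodule R A := (1 ⊔ LinearMap.range j) ^ n

theorem wordFiltration_succ_le (j : M →ₗ[R] A) (n : ℕ) (S : Submodule R A)
    (h1 : wordFiltration j n ≤ S)
    (h2 : ∀ x, ∀ a ∈ wordFiltration j n, j x * a ∈ S) : wordFiltration j (n + 1) ≤ S := by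
  rw [wordFiltration, pow_succ', Submodule.mul_le]
  intro m hm a ha
  obtain ⟨c, hc, y, ⟨x, rfl⟩, rfl⟩ := Submodule.mem_sup.1 hm
  obtain ⟨r, rfl⟩ := Submodule.mem_one.1 hc
  rw [add_mul, ← Algebra.smul_def]
  exact S.add_mem (S.smul_mem _ (h1 ha)) (h2 x a ha)

theorem wordFiltration_mono (j : M →ₗ[R] A) {m n : ℕ} (h : m ≤ n) :
    wordFiltration j m ≤ wordFiltration j n :=
  pow_le_pow_right₀ (M₀ := Submodule R A) (by exact le_sup_left) h

theorem one_mem_wordFiltration (j : M →ₗ[R] A) (n : ℕ) : (1 : A) ∈ wordFiltration j n := by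
  apply wordFiltration_mono j (Nat.zero_le n)
  rw [wordFiltration, pow_zero]
  exact Submodule.mem_one.2 ⟨1, map_one _⟩

theorem mul_mem_wordFiltration (j : M →ₗ[R] A) {n : ℕ} (x : M) {a : A}
    (ha : a ∈ wordFiltration j n) : j x * a ∈ wordFiltration j (n + 1) := by
  rw [wordFiltration, pow_succ']
  exact Submodule.mul_mem_mul (Submodule.mem_sup_right ⟨x, rfl⟩) ha

theorem wordFiltration_induction (j : M →ₗ[R] A) (S : Submodule R A) (h1 : (1 : A) ∈ S)
    (h2 : ∀ n, wordFiltration j n ≤ S → ∀ x, ∀ a ∈ wordFiltration j n, j x * a ∈ S) (n : ℕ) :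
    wordFiltration j n ≤ S := by
  induction n with
  | zero =>
    rw [wordFiltration, pow_zero, Submodule.one_eq_span, Submodule.span_le]
    simpa using h1
  | succ n ih => exact wordFiltration_succ_le j n S ih (h2 n ih)

theorem exists_mem_wordFiltration (j : M →ₗ[R] A)
    (hj : Algebra.adjoin R (Set.range j) = ⊤) (a : A) : ∃ n, a ∈ wordFiltration j n := by
  have ha : a ∈ Algebra.adjoin R (Set.range j) := hj ▸ Algebra.mem_top
  induction ha using Algebra.adjoin_induction with
  | mem x hx =>
    obtain ⟨y, rfl⟩ := hx
    exact ⟨1, by simpa using mul_mem_wordFiltration j y (one_mem_wordFiltration j 0)⟩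
  | algebraMap r =>
    refine ⟨0, ?_⟩
    rw [Algebra.algebraMap_eq_smul_one]
    exact Submodule.smul_mem _ _ (one_mem_wordFiltration j 0)
  | add x y _ _ hx hy =>
    obtain ⟨m, hm⟩ := hx
    obtain ⟨n, hn⟩ := hy
    exact ⟨max m n, Submodule.add_mem _ (wordFiltration_mono j (le_max_left _ _) hm)
      (wordFiltration_mono j (le_max_right _ _) hn)⟩
  | mul x y _ _ hx hy =>
    obtain ⟨m, hm⟩ := hx
    obtain ⟨n, hn⟩ := hy
    refine ⟨m + n, ?_⟩
    rw [wordFiltration, pow_add]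
    exact Submodule.mul_mem_mul hm hn

theorem word_induction (j : M →ₗ[R] A) (hj : Algebra.adjoin R (Set.range j) = ⊤)
    (S : Submodule R A) (h1 : (1 : A) ∈ S)
    (h2 : ∀ n, wordFiltration j n ≤ S → ∀ x, ∀ a ∈ wordFiltration j n, j x * a ∈ S) (a : A) :
    a ∈ S := by
  obtain ⟨n, hn⟩ := exists_mem_wordFiltration j hj a
  exact wordFiltration_induction j S h1 h2 n hn

theorem der_one (D : A →ₗ[R] A) (hD : ∀ a b, D (a * b) = D a * b + a * D b) : D 1 = 0 := by
  simpa using hD 1 1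

theorem der_ext (j : M →ₗ[R] A) (hj : Algebra.adjoin R (Set.range j) = ⊤) (D D' : A →ₗ[R] A)
    (hD : ∀ a b, D (a * b) = D a * b + a * D b) (hD' : ∀ a b, D' (a * b) = D' a * b + a * D' b)
    (h : ∀ x, D (j x) = D' (j x)) (a : A) : D a = D' a :=
  word_induction j hj (LinearMap.eqLocus D D') (by simp [der_one D hD, der_one D' hD'])
    (fun n hn x a ha ↦ by
      have := hn ha
      simp only [LinearMap.mem_eqLocus] at this ⊢
      rw [hD, hD', h, this]) a

theorem der_mem_wordFiltration (j : M →ₗ[R] A) (D : A →ₗ[R] A) (f : M → M)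
    (hD : ∀ a b, D (a * b) = D a * b + a * D b) (h : ∀ x, D (j x) = j (f x)) (n : ℕ) :
    ∀ a ∈ wordFiltration j n, D a ∈ wordFiltration j n := by
  induction n with
  | zero =>
    intro a ha
    rw [wordFiltration, pow_zero] at ha
    obtain ⟨r, rfl⟩ := Submodule.mem_one.1 ha
    rw [Algebra.algebraMap_eq_smul_one, map_smul, der_one D hD, smul_zero]
    exact Submodule.zero_mem _
  | succ n ih =>
    refine wordFiltration_succ_le j n ((wordFiltration j (n + 1)).comap D)
      (fun a ha ↦ wordFiltration_mono j n.le_succ (ih a ha)) fun x a ha ↦ ?_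
    rw [Submodule.mem_comap, hD, h]
    exact Submodule.add_mem _ (mul_mem_wordFiltration j _ ha)
      (mul_mem_wordFiltration j _ (ih a ha))

end Filtration

section TensorAlgebra

variable {R M N E : Type*} [CommRing R] [AddCommGroup M] [Module R M] [AddCommGroup N] [Module R N]
  [AddCommGroup E] [Module R E]

theorem tensorAlgebra_para (e : E) (F : M →ₗ[R] (TensorAlgebra R M × E) →ₗ[R] E) :
    ∃ G : TensorAlgebra R M →ₗ[R] E, G 1 = e ∧
      ∀ x a, G (TensorAlgebra.ι R x * a) = F x (a, G a) := by
  let φ : M →ₗ[R] Module.End R (TensorAlgebra R M × E) :=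
    { toFun := fun x ↦ ((LinearMap.mulLeft R (TensorAlgebra.ι R x)).comp
        (LinearMap.fst R _ _)).prod (F x)
      map_add' := fun x y ↦ by ext <;> simp [add_mul]
      map_smul' := fun r x ↦ by ext <;> simp }
  let Φ := TensorAlgebra.lift R φ
  have h1 : ∀ x a, Φ (TensorAlgebra.ι R x * a) (1, e) =
      (TensorAlgebra.ι R x * (Φ a (1, e)).1, F x (Φ a (1, e))) := fun x a ↦ by
    simp [Φ, φ]
  have h2 : ∀ a, (Φ a (1, e)).1 = a := fun a ↦
    word_induction (TensorAlgebra.ι R) (TensorAlgebra.adjoin_range_ι)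
      (LinearMap.eqLocus ((LinearMap.fst R _ _).comp ((LinearMap.applyₗ (1, e)).comp
        Φ.toLinearMap)) LinearMap.id) (by simp)
      (fun n hn x a ha ↦ by
        have := hn ha
        simp only [LinearMap.mem_eqLocus, LinearMap.comp_apply, LinearMap.fst_apply,
          LinearMap.applyₗ_apply_apply, AlgHom.toLinearMap_apply, LinearMap.id_apply] at this ⊢
        rw [h1, this]) a
  refine ⟨(LinearMap.snd R _ _).comp ((LinearMap.applyₗ (1, e)).comp Φ.toLinearMap),
    by simp, fun x a ↦ ?_⟩
  simp only [LinearMap.comp_apply, LinearMap.snd_apply, LinearMap.applyₗ_apply_apply,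
    AlgHom.toLinearMap_apply]
  rw [h1]
  exact congrArg (F x) (Prod.ext (h2 a) rfl)

theorem tensorAlgebra_der (f : N →ₗ[R] M →ₗ[R] TensorAlgebra R M) :
    ∃ D : N →ₗ[R] TensorAlgebra R M →ₗ[R] TensorAlgebra R M,
      (∀ n x, D n (TensorAlgebra.ι R x) = f n x) ∧
      ∀ n a b, D n (a * b) = D n a * b + a * D n b := by
  let F : M →ₗ[R] (TensorAlgebra R M × (N →ₗ[R] TensorAlgebra R M)) →ₗ[R]
      (N →ₗ[R] TensorAlgebra R M) := LinearMap.mk₂ R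
    (fun x p ↦ (LinearMap.mulRight R p.1).comp (f.flip x) +
      (LinearMap.mulLeft R (TensorAlgebra.ι R x)).comp p.2)
    (fun x y p ↦ by ext; simp [add_mul]; abel) (fun c x p ↦ by ext; simp)
    (fun x p q ↦ by ext; simp [mul_add]; abel) (fun c x p ↦ by ext; simp)
  obtain ⟨G, hG1, hG⟩ := tensorAlgebra_para 0 F
  have hG' : ∀ n x a, G (TensorAlgebra.ι R x * a) n =
      f n x * a + TensorAlgebra.ι R x * G a n := fun n x a ↦ by
    rw [hG]; simp [F]
  refine ⟨G.flip, fun n x ↦ ?_, fun n a b ↦ ?_⟩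
  · have := hG' n x 1
    rw [hG1] at this
    simpa using this
  · refine word_induction (TensorAlgebra.ι R) (TensorAlgebra.adjoin_range_ι)
      (LinearMap.eqLocus ((G.flip n).comp (LinearMap.mulRight R b))
        ((LinearMap.mulRight R b).comp (G.flip n) + LinearMap.mulRight R (G.flip n b)))
      (by simp [hG1]) (fun m hm x a ha ↦ ?_) a
    have := hm ha
    simp only [LinearMap.mem_eqLocus, LinearMap.comp_apply, LinearMap.mulRight_apply,
      LinearMap.add_apply, LinearMap.flip_apply] at this ⊢
    rw [mul_assoc, hG', hG', this]
    noncomm_ring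

theorem tensorAlgebra_rec (f : M →ₗ[R] M →ₗ[R] M)
    (D : M →ₗ[R] TensorAlgebra R M →ₗ[R] TensorAlgebra R M)
    (hD1 : ∀ n x, D n (TensorAlgebra.ι R x) = TensorAlgebra.ι R (f n x))
    (hD2 : ∀ n a b, D n (a * b) = D n a * b + a * D n b)
    (e : E) (l : M →ₗ[R] E →ₗ[R] E) :
    ∃ T : TensorAlgebra R M →ₗ[R] E, T 1 = e ∧
      ∀ x a, T (TensorAlgebra.ι R x * a) = l x (T a) - T (D x a) := by
  let W := wordFiltration (TensorAlgebra.ι R : M →ₗ[R] TensorAlgebra R M)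
  have hstep : ∀ t : TensorAlgebra R M →ₗ[R] E, ∃ t' : TensorAlgebra R M →ₗ[R] E, t' 1 = e ∧
      ∀ x a, t' (TensorAlgebra.ι R x * a) = l x (t a) - t (D x a) := fun t ↦ by
    obtain ⟨G, h1, h2⟩ := tensorAlgebra_para e
      (LinearMap.mk₂ R (fun x (p : TensorAlgebra R M × E) ↦ l x (t p.1) - t (D x p.1))
        (fun x y p ↦ by simp; abel) (fun c x p ↦ by simp [smul_sub])
        (fun x p q ↦ by simp; abel) (fun c x p ↦ by simp [smul_sub]))
    exact ⟨G, h1, fun x a ↦ by rw [h2]; simp⟩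
  choose next hn1 hn2 using hstep
  let t : ℕ → TensorAlgebra R M →ₗ[R] E := fun n ↦ Nat.rec (next 0) (fun _ s ↦ next s) n
  have ht1 : ∀ n, t n 1 = e := fun n ↦ by cases n <;> exact hn1 _
  have ht2 : ∀ n x a, t (n + 1) (TensorAlgebra.ι R x * a) = l x (t n a) - t n (D x a) :=
    fun n x a ↦ hn2 _ _ _
  have hstab : ∀ n, ∀ a ∈ W n, ∀ m, n ≤ m → t (m + 1) a = t m a := by
    intro n
    induction n with
    | zero =>
      intro a ha m _
      simp only [W, wordFiltration, pow_zero] at ha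
      obtain ⟨r, rfl⟩ := Submodule.mem_one.1 ha
      rw [Algebra.algebraMap_eq_smul_one, map_smul, map_smul, ht1 (m + 1), ht1 m]
    | succ n ih =>
      intro a ha m hm
      obtain ⟨m, rfl⟩ : ∃ k, m = k + 1 := ⟨m - 1, by omega⟩
      refine wordFiltration_succ_le (TensorAlgebra.ι R) n
        (LinearMap.eqLocus (t (m + 1 + 1)) (t (m + 1)))
        (fun a ha ↦ LinearMap.mem_eqLocus.2 (ih a ha (m + 1) (by omega))) (fun x a ha ↦ ?_) ha
      rw [LinearMap.mem_eqLocus, ht2 (m + 1), ht2 m, ih a ha m (by omega),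
        ih _ (der_mem_wordFiltration _ (D x) (f x) (hD2 x) (hD1 x) n a ha) m (by omega)]
  have hstab' : ∀ n, ∀ a ∈ W n, ∀ m, n ≤ m → t m a = t n a := by
    intro n a ha m hm
    induction m, hm using Nat.le_induction with
    | base => rfl
    | succ m hm ih => rw [hstab n a ha m hm, ih]
  choose N hN using fun a ↦ exists_mem_wordFiltration (TensorAlgebra.ι R : M →ₗ[R] _)
    TensorAlgebra.adjoin_range_ι a
  have hT : ∀ a n, a ∈ W n → t (N a) a = t n a := fun a n ha ↦ by
    rw [← hstab' _ a ha (max n (N a)) (le_max_left _ _),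
      ← hstab' _ a (hN a) (max n (N a)) (le_max_right _ _)]
  let T : TensorAlgebra R M →ₗ[R] E :=
    { toFun := fun a ↦ t (N a) a
      map_add' := fun a b ↦ by
        have ha := wordFiltration_mono (TensorAlgebra.ι R) (le_max_left (N a) (N b)) (hN a)
        have hb := wordFiltration_mono (TensorAlgebra.ι R) (le_max_right (N a) (N b)) (hN b)
        rw [hT _ _ ha, hT _ _ hb, hT _ _ (Submodule.add_mem _ ha hb), map_add]
      map_smul' := fun c a ↦ by
        rw [hT _ _ (Submodule.smul_mem _ c (hN a)), map_smul, RingHom.id_apply] }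
  refine ⟨T, ht1 _, fun x a ↦ ?_⟩
  change t _ _ = l x (t _ _) - t _ _
  rw [hT _ _ (mul_mem_wordFiltration _ x (hN a)), ht2,
    hT (D x a) (N a) (der_mem_wordFiltration _ (D x) (f x) (hD2 x) (hD1 x) _ a (hN a))]

end TensorAlgebra
end PostLie

namespace PostLie
section Enveloping
attribute [local instance 100] LieRing.ofAssociativeRing

variable {R L N : Type*} [CommRing R] [LieRing L] [LieAlgebra R L] [AddCommGroup N] [Module R N]

theorem uea_ι_lie (x y : L) : UniversalEnvelopingAlgebra.ι R ⁅x, y⁆ =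
    UniversalEnvelopingAlgebra.ι R x * UniversalEnvelopingAlgebra.ι R y -
      UniversalEnvelopingAlgebra.ι R y * UniversalEnvelopingAlgebra.ι R x := by
  rw [LieHom.map_lie, LieRing.of_associative_ring_bracket]

theorem uea_adjoin : Algebra.adjoin R (Set.range
    (UniversalEnvelopingAlgebra.ι R : L →ₗ⁅R⁆ UniversalEnvelopingAlgebra R L).toLinearMap) = ⊤ := by
  have hs : Function.Surjective (UniversalEnvelopingAlgebra.mkAlgHom R L) :=
    RingCon.mkₐ_surjective _
  rw [← (AlgHom.range_eq_top _).2 hs, ← Algebra.map_top, ← TensorAlgebra.adjoin_range_ι,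
    AlgHom.map_adjoin, ← Set.range_comp]
  rfl

/-- The coshuffle coproduct of the enveloping algebra: the algebra morphism with
`x ↦ x ⊗ 1 + 1 ⊗ x` for `x` in the Lie algebra. -/
def comul (R L : Type*) [CommRing R] [LieRing L] [LieAlgebra R L] :
    UniversalEnvelopingAlgebra R L →ₐ[R]
      UniversalEnvelopingAlgebra R L ⊗[R] UniversalEnvelopingAlgebra R L :=
  UniversalEnvelopingAlgebra.lift R
    { toFun := fun x ↦ UniversalEnvelopingAlgebra.ι R x ⊗ₜ[R] 1 +
        1 ⊗ₜ[R] UniversalEnvelopingAlgebra.ι R x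
      map_add' := fun x y ↦ by
        rw [map_add, TensorProduct.add_tmul, TensorProduct.tmul_add]; abel
      map_smul' := fun c x ↦ by
        rw [map_smul, TensorProduct.tmul_smul, ← TensorProduct.smul_tmul', smul_add,
          RingHom.id_apply]
      map_lie' := fun {x y} ↦ by
        rw [uea_ι_lie, LieRing.of_associative_ring_bracket]
        simp only [TensorProduct.sub_tmul, TensorProduct.tmul_sub, add_mul, mul_add,
          Algebra.TensorProduct.tmul_mul_tmul, one_mul, mul_one]
        abel }

theorem comul_ι (x : L) : comul R L (UniversalEnvelopingAlgebra.ι R x) =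
    UniversalEnvelopingAlgebra.ι R x ⊗ₜ[R] 1 + 1 ⊗ₜ[R] UniversalEnvelopingAlgebra.ι R x :=
  UniversalEnvelopingAlgebra.lift_ι_apply R _ x

theorem uea_der (f : N →ₗ[R] L →ₗ[R] L)
    (hf : ∀ n x y, f n ⁅x, y⁆ = ⁅f n x, y⁆ + ⁅x, f n y⁆) :
    ∃ D : N →ₗ[R] UniversalEnvelopingAlgebra R L →ₗ[R] UniversalEnvelopingAlgebra R L,
      (∀ n x, D n (UniversalEnvelopingAlgebra.ι R x) = UniversalEnvelopingAlgebra.ι R (f n x)) ∧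
      ∀ n a b, D n (a * b) = D n a * b + a * D n b := by
  let U := UniversalEnvelopingAlgebra R L
  let F : L →ₗ[R] (U × (N →ₗ[R] U)) →ₗ[R] (N →ₗ[R] U) := LinearMap.mk₂ R
    (fun x p ↦ (LinearMap.mulRight R p.1).comp
        ((UniversalEnvelopingAlgebra.ι R).toLinearMap.comp (f.flip x)) +
      (LinearMap.mulLeft R (UniversalEnvelopingAlgebra.ι R x)).comp p.2)
    (fun x y p ↦ by ext; simp [-UniversalEnvelopingAlgebra.ι_apply, add_mul]; abel)
    (fun c x p ↦ by ext; simp [-UniversalEnvelopingAlgebra.ι_apply])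
    (fun x p q ↦ by ext; simp [-UniversalEnvelopingAlgebra.ι_apply, mul_add]; abel)
    (fun c x p ↦ by ext; simp [-UniversalEnvelopingAlgebra.ι_apply])
  have hF : ∀ x p n, F x p n = UniversalEnvelopingAlgebra.ι R (f n x) * p.1 +
      UniversalEnvelopingAlgebra.ι R x * p.2 n := fun x p n ↦ rfl
  let φ : L →ₗ⁅R⁆ Module.End R (U × (N →ₗ[R] U)) :=
    { toFun := fun x ↦ ((LinearMap.mulLeft R (UniversalEnvelopingAlgebra.ι R x)).comp
        (LinearMap.fst R _ _)).prod (F x)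
      map_add' := fun x y ↦ by
        apply LinearMap.ext; intro p
        refine Prod.ext ?_ ?_
        · simp [-UniversalEnvelopingAlgebra.ι_apply, add_mul]
        · simp
      map_smul' := fun c x ↦ by
        apply LinearMap.ext; intro p
        refine Prod.ext ?_ ?_
        · simp [-UniversalEnvelopingAlgebra.ι_apply]
        · simp
      map_lie' := fun {x y} ↦ by
        rw [LieRing.of_associative_ring_bracket]
        apply LinearMap.ext; intro p
        refine Prod.ext ?_ ?_
        · simp [-UniversalEnvelopingAlgebra.ι_apply]
          rw [LieRing.of_associative_ring_bracket, sub_mul, mul_assoc, mul_assoc]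
        · apply LinearMap.ext; intro n
          simp only [LinearMap.prod_apply, Function.prod_apply, LinearMap.sub_apply,
            Prod.snd_sub, Module.End.mul_apply, hF, LinearMap.comp_apply, LinearMap.fst_apply,
            LinearMap.mulLeft_apply, hf, map_add, uea_ι_lie]
          noncomm_ring }
  let Φ := UniversalEnvelopingAlgebra.lift R φ
  have h1 : ∀ x a, Φ (UniversalEnvelopingAlgebra.ι R x * a) (1, 0) =
      (UniversalEnvelopingAlgebra.ι R x * (Φ a (1, 0)).1, F x (Φ a (1, 0))) := fun x a ↦ by
    rw [map_mul, UniversalEnvelopingAlgebra.lift_ι_apply]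
    rfl
  have h2 : ∀ a, (Φ a (1, 0)).1 = a := fun a ↦
    word_induction _ uea_adjoin
      (LinearMap.eqLocus ((LinearMap.fst R _ _).comp ((LinearMap.applyₗ (1, 0)).comp
        Φ.toLinearMap)) LinearMap.id) (by simp)
      (fun n hn x a ha ↦ by
        have := hn ha
        simp only [LinearMap.mem_eqLocus, LinearMap.comp_apply, LinearMap.fst_apply,
          LinearMap.applyₗ_apply_apply, AlgHom.toLinearMap_apply, LinearMap.id_apply] at this ⊢
        erw [h1]
        rw [this]
        rfl) a
  let G := (LinearMap.snd R _ _).comp ((LinearMap.applyₗ (1, 0)).comp Φ.toLinearMap)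
  have hG1 : G 1 = 0 := by simp [G]
  have hG' : ∀ n x a, G (UniversalEnvelopingAlgebra.ι R x * a) n =
      UniversalEnvelopingAlgebra.ι R (f n x) * a + UniversalEnvelopingAlgebra.ι R x * G a n :=
    fun n x a ↦ by
      have : G (UniversalEnvelopingAlgebra.ι R x * a) = F x (Φ a (1, 0)) :=
        congrArg Prod.snd (h1 x a)
      rw [this, hF, h2]
      rfl
  refine ⟨G.flip, fun n x ↦ ?_, fun n a b ↦ ?_⟩
  · have := hG' n x 1
    rw [hG1, mul_one, mul_one, LinearMap.zero_apply, mul_zero, add_zero] at this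
    exact this
  · refine word_induction _ uea_adjoin
      (LinearMap.eqLocus ((G.flip n).comp (LinearMap.mulRight R b))
        ((LinearMap.mulRight R b).comp (G.flip n) + LinearMap.mulRight R (G.flip n b)))
      (by simp [hG1]) (fun m hm x a ha ↦ ?_) a
    have := hm ha
    simp only [LinearMap.mem_eqLocus, LinearMap.comp_apply, LinearMap.mulRight_apply,
      LinearMap.add_apply, LinearMap.flip_apply, LieHom.coe_toLinearMap] at this ⊢
    rw [mul_assoc, hG', hG', this]
    noncomm_ring

end Enveloping
end PostLie

/-- A post-Lie product on a Lie algebra. -/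
structure PostLieProduct (R L : Type*) [CommRing R] [LieRing L] [LieAlgebra R L] where
  /-- The bilinear product `x ▷ y`. -/
  tr : L →ₗ[R] L →ₗ[R] L
  tr_lie : ∀ x y z, tr x ⁅y, z⁆ = ⁅tr x y, z⁆ + ⁅y, tr x z⁆
  lie_tr : ∀ x y z, tr ⁅x, y⁆ z =
    (tr x (tr y z) - tr (tr x y) z) - (tr y (tr x z) - tr (tr y x) z)

namespace PostLie
section Extension
attribute [local instance 100] LieRing.ofAssociativeRing

variable {R L : Type*} [CommRing R] [LieRing L] [LieAlgebra R L]

/-- `T A B` is an extension `A ▷ B` of the post-Lie product to the enveloping algebra. In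
`mul`, if `Δ A = ∑ A₁ ⊗ A₂` then the right-hand side is `∑ (A₁ ▷ B) (A₂ ▷ C)`. -/
structure IsExtension (P : PostLieProduct R L) (T : UniversalEnvelopingAlgebra R L →ₗ[R]
    UniversalEnvelopingAlgebra R L →ₗ[R] UniversalEnvelopingAlgebra R L) : Prop where
  ι_ι : ∀ x y : L, T (UniversalEnvelopingAlgebra.ι R x) (UniversalEnvelopingAlgebra.ι R y) =
    UniversalEnvelopingAlgebra.ι R (P.tr x y)
  one : ∀ A, T 1 A = A
  ι_mul : ∀ (x y : L) A, T (UniversalEnvelopingAlgebra.ι R x * A)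
      (UniversalEnvelopingAlgebra.ι R y) =
    T (UniversalEnvelopingAlgebra.ι R x) (T A (UniversalEnvelopingAlgebra.ι R y)) -
      T (T (UniversalEnvelopingAlgebra.ι R x) A) (UniversalEnvelopingAlgebra.ι R y)
  mul : ∀ A B C, T A (B * C) =
    LinearMap.mul' R _ (TensorProduct.map (T.flip B) (T.flip C) (comul R L A))

variable (P : PostLieProduct R L)

local notation "U" => UniversalEnvelopingAlgebra R L
local notation "ι" => UniversalEnvelopingAlgebra.ι R

/-- Existence for the recursion `(x A) ▷ B = x ▷ (A ▷ B) - (x ▷ A) ▷ B`. -/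
theorem exists_recursive : ∃ T : U →ₗ[R] U →ₗ[R] U,
    (∀ x y : L, T (ι x) (ι y) = ι (P.tr x y)) ∧
    (∀ x : L, ∀ a b, T (ι x) (a * b) = T (ι x) a * b + a * T (ι x) b) ∧
    (∀ b, T 1 b = b) ∧
    (∀ x : L, ∀ a b, T (ι x * a) b = T (ι x) (T a b) - T (T (ι x) a) b) := by
  obtain ⟨d, hd1, hd2⟩ := uea_der P.tr P.tr_lie
  obtain ⟨δ, hδ1, hδ2⟩ := tensorAlgebra_der
    (P.tr.compr₂ (TensorAlgebra.ι R : L →ₗ[R] TensorAlgebra R L))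
  simp only [LinearMap.compr₂_apply] at hδ1
  obtain ⟨T, hT1, hT2⟩ := tensorAlgebra_rec P.tr δ hδ1 hδ2 (1 : Module.End R U)
    (LinearMap.mk₂ R (fun x e ↦ (d x).comp e) (fun x y e ↦ by ext; simp)
      (fun c x e ↦ by ext; simp) (fun x e e' ↦ by ext; simp) (fun c x e ↦ by ext; simp))
  simp only [LinearMap.mk₂_apply] at hT2
  let j : L →ₗ[R] TensorAlgebra R L := TensorAlgebra.ι R
  have hd3 : ∀ x y b, d ⁅x, y⁆ b =
      (d x (d y b) - d (P.tr x y) b) - (d y (d x b) - d (P.tr y x) b) := fun x y b ↦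
    der_ext _ uea_adjoin (d ⁅x, y⁆) (((d x).comp (d y) - d (P.tr x y)) -
      ((d y).comp (d x) - d (P.tr y x))) (hd2 _)
      (fun a b ↦ by simp [hd2]; noncomm_ring)
      (fun z ↦ by
        simp only [LinearMap.sub_apply, LinearMap.comp_apply, LieHom.coe_toLinearMap, hd1,
          P.lie_tr, map_sub]) b
  have hδ3 : ∀ x y b, δ ⁅x, y⁆ b =
      (δ x (δ y b) - δ (P.tr x y) b) - (δ y (δ x b) - δ (P.tr y x) b) := fun x y b ↦
    der_ext _ TensorAlgebra.adjoin_range_ι (δ ⁅x, y⁆) (((δ x).comp (δ y) - δ (P.tr x y)) -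
      ((δ y).comp (δ x) - δ (P.tr y x))) (hδ2 _)
      (fun a b ↦ by simp [hδ2]; noncomm_ring)
      (fun z ↦ by
        simp only [LinearMap.sub_apply, LinearMap.comp_apply, hδ1, P.lie_tr, map_sub]) b
  let r : L → L → TensorAlgebra R L := fun x y ↦ j ⁅x, y⁆ - (j x * j y - j y * j x)
  have hδr : ∀ z x y, δ z (r x y) = r (P.tr z x) y + r x (P.tr z y) := fun z x y ↦ by
    simp only [r, j, map_sub, hδ1, hδ2, P.tr_lie, map_add]
    noncomm_ring
  have hr1 : ∀ x y q, T (r x y * q) = 0 := fun x y q ↦ by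
    apply LinearMap.ext; intro b
    simp only [r, j, sub_mul, map_sub, mul_assoc, hT2, hδ2, hδ1, map_add, LinearMap.sub_apply,
      LinearMap.comp_apply, LinearMap.add_apply, hd3, hδ3, LinearMap.zero_apply]
    abel
  have hr : ∀ p x y q, T (p * r x y * q) = 0 := by
    intro p
    let S : Submodule R (TensorAlgebra R L) :=
      { carrier := {p | ∀ x y q, T (p * r x y * q) = 0}
        add_mem' := fun {a b} ha hb x y q ↦ by rw [add_mul, add_mul, map_add, ha, hb, add_zero]
        zero_mem' := fun x y q ↦ by simp
        smul_mem' := fun c a ha x y q ↦ by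
          rw [smul_mul_assoc, smul_mul_assoc, map_smul, ha, smul_zero] }
    refine word_induction j TensorAlgebra.adjoin_range_ι S (fun x y q ↦ by
      rw [one_mul, hr1]) (fun n hn z a ha x y q ↦ ?_) p
    have h1 := hn ha
    have h2 := hn (der_mem_wordFiltration _ (δ z) (P.tr z) (hδ2 z) (hδ1 z) n a ha)
    rw [mul_assoc, mul_assoc, hT2, ← mul_assoc, h1 x y q, hδ2, hδ2, hδr, add_mul, mul_add,
      add_mul, map_add, map_add, map_add, h2 x y q, h1, h1, h1]
    simp
  let c : RingCon (TensorAlgebra R L) :=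
    { r := fun a a' ↦ ∀ p q, T (p * a * q) = T (p * a' * q)
      iseqv := ⟨fun _ _ _ ↦ rfl, fun h p q ↦ (h p q).symm, fun h h' p q ↦ (h p q).trans (h' p q)⟩
      add' := fun {a b a' b'} h h' p q ↦ by
        rw [mul_add, mul_add, add_mul, add_mul, map_add, map_add, h, h']
      mul' := fun {a b a' b'} h h' p q ↦ by
        rw [← mul_assoc, mul_assoc _ a', h, ← mul_assoc, ← mul_assoc p, h'] }
  have hc : ∀ a a', c a a' ↔ ∀ p q, T (p * a * q) = T (p * a' * q) := fun a a' ↦ Iff.rfl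
  let Q := c.mkₐ (α := R)
  have hQ : ∀ a a', Q a = Q a' ↔ c a a' := fun a a' ↦ c.eq
  let _ := LieRing.ofAssociativeRing (A := c.Quotient)
  let _ := LieAlgebra.ofAssociativeAlgebra (R := R) (A := c.Quotient)
  let fl : L →ₗ⁅R⁆ c.Quotient :=
    { Q.toLinearMap.comp j with
      map_lie' := fun {x y} ↦ by
        change Q (j ⁅x, y⁆) = Q (j x) * Q (j y) - Q (j y) * Q (j x)
        rw [← map_mul Q, ← map_mul Q, ← map_sub Q, hQ, hc]
        intro p q
        have := hr p x y q
        simp only [r, mul_sub, sub_mul, map_sub] at this ⊢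
        exact sub_eq_zero.1 this }
  let lf := UniversalEnvelopingAlgebra.lift R fl
  let π := UniversalEnvelopingAlgebra.mkAlgHom R L
  have hπ : Function.Surjective π := RingCon.mkₐ_surjective _
  have hπj : ∀ x, π (j x) = ι x := fun x ↦ rfl
  have hlf : ∀ a, lf (π a) = Q a := fun a ↦ by
    have : lf.comp π = Q := by
      apply TensorAlgebra.hom_ext
      ext x
      exact UniversalEnvelopingAlgebra.lift_ι_apply R fl x
    exact DFunLike.congr_fun this a
  have hwd : ∀ a a', π a = π a' → T a = T a' := fun a a' h ↦ by
    have := (hc a a').1 ((hQ a a').1 (by rw [← hlf, ← hlf, h])) 1 1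
    simpa using this
  have hπδ : ∀ x a, π (δ x a) = d x (π a) := fun x a ↦ by
    refine word_induction j TensorAlgebra.adjoin_range_ι
      (LinearMap.eqLocus (π.toLinearMap.comp (δ x)) ((d x).comp π.toLinearMap)) ?_
      (fun n hn y a ha ↦ ?_) a
    · simp [der_one _ (hδ2 x), der_one _ (hd2 x)]
    · have := hn ha
      simp only [LinearMap.mem_eqLocus, LinearMap.comp_apply, AlgHom.toLinearMap_apply] at this ⊢
      simp only [hδ2, map_add, map_mul, this, j, hδ1, hd2]
      simp only [hπj, j, hd1] at *
  let s := Function.surjInv hπ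
  have hs : ∀ a, π (s a) = a := Function.surjInv_eq hπ
  let T' : U →ₗ[R] U →ₗ[R] U :=
    { toFun := fun a ↦ T (s a)
      map_add' := fun a b ↦ by
        rw [← map_add]; exact hwd _ _ (by rw [map_add, hs, hs, hs])
      map_smul' := fun c a ↦ by
        rw [RingHom.id_apply, ← map_smul]; exact hwd _ _ (by rw [map_smul, hs, hs]) }
  have hT' : ∀ a, T' (π a) = T a := fun a ↦ hwd _ _ (hs _)
  have h1 : T' 1 = 1 := by rw [← map_one π, hT', hT1]
  have h2 : ∀ x a, T' (ι x * a) = (d x).comp (T' a) - T' (d x a) := fun x a ↦ by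
    obtain ⟨a, rfl⟩ := hπ a
    rw [← hπj, ← map_mul, hT', hT2, ← hπδ, hT', hT']
  have h3 : ∀ x, T' (ι x) = d x := fun x ↦ by
    have := h2 x 1
    rw [mul_one, h1, der_one _ (hd2 x), map_zero, sub_zero] at this
    exact this
  refine ⟨T', fun x y ↦ by rw [h3, hd1], fun x a b ↦ by rw [h3, hd2],
    fun b ↦ by rw [h1]; rfl, fun x a b ↦ ?_⟩
  rw [h2, h3]; rfl

/-- The linear map `∑ a₁ ⊗ a₂ ↦ ∑ g a₁ * h a₂`. -/
def mulMap (g h : U →ₗ[R] U) : U ⊗[R] U →ₗ[R] U :=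
  (LinearMap.mul' R U).comp (TensorProduct.map g h)

theorem mulMap_tmul (g h : U →ₗ[R] U) (a b : U) : mulMap g h (a ⊗ₜ b) = g a * h b := rfl

theorem mulMap_ι_mul (g h : U →ₗ[R] U) (x : L) (w : U ⊗[R] U) :
    mulMap g h (comul R L (ι x) * w) =
      mulMap (g.comp (LinearMap.mulLeft R (ι x))) h w +
        mulMap g (h.comp (LinearMap.mulLeft R (ι x))) w := by
  induction w using TensorProduct.induction_on with
  | zero => simp
  | add u v hu hv => rw [mul_add, map_add, map_add, map_add, hu, hv]; abel
  | tmul a b =>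
    rw [comul_ι, add_mul, Algebra.TensorProduct.tmul_mul_tmul,
      Algebra.TensorProduct.tmul_mul_tmul, map_add, one_mul, one_mul]
    rfl

theorem comul_der (D : U →ₗ[R] U) (f : L → L) (hD : ∀ a b, D (a * b) = D a * b + a * D b)
    (hDι : ∀ y, D (ι y) = ι (f y)) (a : U) :
    comul R L (D a) = TensorProduct.map D LinearMap.id (comul R L a) +
      TensorProduct.map LinearMap.id D (comul R L a) := by
  refine word_induction _ uea_adjoin (LinearMap.eqLocus ((comul R L).toLinearMap.comp D)
    ((TensorProduct.map D LinearMap.id + TensorProduct.map LinearMap.id D).comp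
      (comul R L).toLinearMap)) ?_ (fun n hn x a ha ↦ ?_) a
  · simp [der_one D hD, Algebra.TensorProduct.one_def]
  · have := hn ha
    simp only [LinearMap.mem_eqLocus, LinearMap.comp_apply, AlgHom.toLinearMap_apply,
      LinearMap.add_apply, LieHom.coe_toLinearMap] at this ⊢
    rw [hD, map_add, map_mul, map_mul, map_mul, this, hDι]
    generalize comul R L a = w
    induction w using TensorProduct.induction_on with
    | zero => simp
    | add u v hu hv =>
      simp only [mul_add, map_add] at hu hv ⊢
      linear_combination (norm := abel) hu + hv
    | tmul b c =>
      simp only [comul_ι, add_mul, mul_add, Algebra.TensorProduct.tmul_mul_tmul, map_add,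
        TensorProduct.map_tmul, LinearMap.id_apply, one_mul, hD, hDι, TensorProduct.add_tmul,
        TensorProduct.tmul_add]
      abel

theorem exists_isExtension : ∃ T, IsExtension P T := by
  obtain ⟨T, h1, h2, h3, h4⟩ := exists_recursive P
  refine ⟨T, h1, h3, fun x y A ↦ h4 _ _ _, fun A B C ↦ ?_⟩
  let S : Submodule R U :=
    { carrier := {A | ∀ B C, T A (B * C) = mulMap (T.flip B) (T.flip C) (comul R L A)}
      add_mem' := fun {a b} ha hb B C ↦ by rw [map_add, map_add, map_add, ← ha, ← hb]; rfl
      zero_mem' := fun B C ↦ by simp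
      smul_mem' := fun c a ha B C ↦ by rw [map_smul, map_smul, map_smul, ← ha]; rfl }
  refine word_induction _ uea_adjoin S (fun B C ↦ ?_) (fun n hn x a ha B C ↦ ?_) A B C
  · rw [map_one (comul R L), Algebra.TensorProduct.one_def, mulMap_tmul]
    simp [h3]
  · have e1 := hn ha B C
    have e2 := hn (der_mem_wordFiltration _ (T (ι x)) (P.tr x) (h2 x) (h1 x) n a ha) B C
    rw [LieHom.coe_toLinearMap, map_mul (comul R L), h4, e1, e2, mulMap_ι_mul,
      comul_der (T (ι x)) (P.tr x) (h2 x) (h1 x)]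
    generalize comul R L a = w
    induction w using TensorProduct.induction_on with
    | zero => simp
    | add u v hu hv =>
      simp only [map_add] at hu hv ⊢
      linear_combination (norm := abel) hu + hv
    | tmul b c =>
      simp only [TensorProduct.map_tmul, mulMap_tmul, map_add, LinearMap.id_apply,
        LinearMap.flip_apply, LinearMap.comp_apply, LinearMap.mulLeft_apply, h2, h4]
      noncomm_ring

theorem mulMap_comul_eq_zero (n : ℕ) : ∀ (g h : U →ₗ[R] U),
    (∀ a ∈ wordFiltration (ι : L →ₗ⁅R⁆ U).toLinearMap n, g a = 0) →
    ∀ a ∈ wordFiltration (ι : L →ₗ⁅R⁆ U).toLinearMap n, mulMap g h (comul R L a) = 0 ∧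
      mulMap h g (comul R L a) = 0 := by
  induction n with
  | zero =>
    intro g h hg a ha
    have h1 := hg 1 (one_mem_wordFiltration _ 0)
    rw [wordFiltration, pow_zero] at ha
    obtain ⟨r, rfl⟩ := Submodule.mem_one.1 ha
    rw [Algebra.algebraMap_eq_smul_one, map_smul, map_one, Algebra.TensorProduct.one_def,
      map_smul, map_smul, mulMap_tmul, mulMap_tmul, h1]
    simp
  | succ n ih =>
    intro g h hg a ha
    have hg' := fun a ha ↦ hg a (wordFiltration_mono _ n.le_succ ha)
    have := wordFiltration_succ_le (ι : L →ₗ⁅R⁆ U).toLinearMap n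
      (LinearMap.ker ((mulMap g h).comp (comul R L).toLinearMap) ⊓
        LinearMap.ker ((mulMap h g).comp (comul R L).toLinearMap))
      (fun a ha ↦ ih g h hg' a ha) (fun x a ha ↦ ?_) ha
    · exact this
    · have hx : ∀ b ∈ wordFiltration (ι : L →ₗ⁅R⁆ U).toLinearMap n,
          (g.comp (LinearMap.mulLeft R (ι x))) b = 0 := fun b hb ↦
        hg _ (mul_mem_wordFiltration (ι : L →ₗ⁅R⁆ U).toLinearMap x hb)
      constructor
      · change mulMap g h (comul R L (ι x * a)) = 0
        rw [map_mul (comul R L), mulMap_ι_mul, (ih _ _ hx a ha).1, (ih _ _ hg' a ha).1, add_zero]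
      · change mulMap h g (comul R L (ι x * a)) = 0
        rw [map_mul (comul R L), mulMap_ι_mul, (ih _ _ hx a ha).2, (ih _ _ hg' a ha).2, add_zero]

/-- The counit followed by the unit. -/
def counitMap : U →ₗ[R] U :=
  (Algebra.linearMap R U).comp (UniversalEnvelopingAlgebra.lift R (0 : L →ₗ⁅R⁆ R)).toLinearMap

theorem counitMap_one : counitMap (1 : U) = 1 := by simp [counitMap]

theorem counitMap_ι_mul (x : L) (a : U) : counitMap (ι x * a) = 0 := by
  simp only [counitMap, LinearMap.comp_apply, AlgHom.toLinearMap_apply, map_mul,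
    UniversalEnvelopingAlgebra.lift_ι_apply]
  simp

theorem counitMap_eq_smul (a : U) : ∃ r : R, counitMap a = r • (1 : U) :=
  ⟨_, Algebra.algebraMap_eq_smul_one (UniversalEnvelopingAlgebra.lift R (0 : L →ₗ⁅R⁆ R) a)⟩

theorem counitMap_der (D : U →ₗ[R] U) (f : L → L) (hD : ∀ a b, D (a * b) = D a * b + a * D b)
    (hDι : ∀ y, D (ι y) = ι (f y)) (a : U) : counitMap (D a) = 0 := by
  refine word_induction _ uea_adjoin (LinearMap.ker (counitMap.comp D)) ?_ (fun n hn x a ha ↦ ?_) a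
  · simp [der_one D hD]
  · rw [LinearMap.mem_ker, LinearMap.comp_apply, LieHom.coe_toLinearMap, hD, hDι, map_add,
      counitMap_ι_mul, counitMap_ι_mul, add_zero]

theorem mulMap_counit (a : U) : ∀ g : U →ₗ[R] U, mulMap counitMap g (comul R L a) = g a ∧
    mulMap g counitMap (comul R L a) = g a := by
  let S : Submodule R U :=
    { carrier := {a | ∀ g : U →ₗ[R] U, mulMap counitMap g (comul R L a) = g a ∧
        mulMap g counitMap (comul R L a) = g a}
      add_mem' := fun {a b} ha hb g ↦ by
        simp only [map_add, (ha g).1, (ha g).2, (hb g).1, (hb g).2, and_self]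
      zero_mem' := fun g ↦ by simp
      smul_mem' := fun c a ha g ↦ by simp only [map_smul, (ha g).1, (ha g).2, and_self] }
  refine word_induction _ uea_adjoin S (fun g ↦ ?_) (fun n hn x a ha g ↦ ?_) a
  · rw [map_one (comul R L), Algebra.TensorProduct.one_def, mulMap_tmul, mulMap_tmul,
      counitMap_one, one_mul, mul_one, and_self]
  · have hz : counitMap.comp (LinearMap.mulLeft R (ι x)) = 0 :=
      LinearMap.ext fun a ↦ counitMap_ι_mul x a
    have h0 : ∀ g, mulMap (0 : U →ₗ[R] U) g (comul R L a) = 0 := fun g ↦ by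
      simp [mulMap]
    have h0' : ∀ g, mulMap g (0 : U →ₗ[R] U) (comul R L a) = 0 := fun g ↦ by
      simp [mulMap]
    rw [LieHom.coe_toLinearMap, map_mul (comul R L), mulMap_ι_mul, mulMap_ι_mul, hz, h0, h0',
      zero_add, add_zero, (hn ha _).1, (hn ha _).2]
    exact ⟨rfl, rfl⟩

namespace IsExtension

variable {P} {T : UniversalEnvelopingAlgebra R L →ₗ[R]
    UniversalEnvelopingAlgebra R L →ₗ[R] UniversalEnvelopingAlgebra R L}

theorem mul' (hT : IsExtension P T) (A B C : U) :
    T A (B * C) = mulMap (T.flip B) (T.flip C) (comul R L A) := hT.mul A B C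

theorem der (hT : IsExtension P T) (x : L) (a b : U) :
    T (ι x) (a * b) = T (ι x) a * b + a * T (ι x) b := by
  rw [hT.mul', comul_ι, map_add, mulMap_tmul, mulMap_tmul]
  simp [-UniversalEnvelopingAlgebra.ι_apply, hT.one]

theorem apply_one (hT : IsExtension P T) (A : U) : T A 1 = counitMap A := by
  let N : U →ₗ[R] U := T.flip 1 - counitMap
  have hN : ∀ a, mulMap N N (comul R L a) = - N a := fun a ↦ by
    have h1 : mulMap N N = mulMap (T.flip 1) (T.flip 1) - mulMap counitMap (T.flip 1) -
        (mulMap (T.flip 1) counitMap - mulMap counitMap counitMap) := by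
      ext a b
      simp only [N, mulMap_tmul, TensorProduct.AlgebraTensorModule.curry_apply,
        TensorProduct.curry_apply, LinearMap.restrictScalars_self, LinearMap.sub_apply]
      noncomm_ring
    rw [h1, LinearMap.sub_apply, LinearMap.sub_apply, LinearMap.sub_apply, ← hT.mul', mul_one,
      (mulMap_counit a _).1, (mulMap_counit a _).1, (mulMap_counit a _).2]
    simp [N]
  have h0 : N A = 0 := by
    refine word_induction _ uea_adjoin (LinearMap.ker N) ?_ (fun n hn x a ha ↦ ?_) A
    · simp [N, hT.one, counitMap_one]
    · have h2 := hN (ι x * a)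
      rw [map_mul (comul R L), mulMap_ι_mul, (mulMap_comul_eq_zero n N _ hn a ha).1,
        (mulMap_comul_eq_zero n N _ hn a ha).2, add_zero] at h2
      exact neg_eq_zero.1 h2.symm
  exact sub_eq_zero.1 h0

theorem ι_mul_apply (hT : IsExtension P T) (x : L) (A B : U) :
    T (ι x * A) B = T (ι x) (T A B) - T (T (ι x) A) B := by
  let S : Submodule R U :=
    { carrier := {B | ∀ A, T (ι x * A) B = T (ι x) (T A B) - T (T (ι x) A) B}
      add_mem' := fun {a b} ha hb A ↦ by simp only [map_add, ha A, hb A]; abel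
      zero_mem' := fun A ↦ by simp
      smul_mem' := fun c a ha A ↦ by simp only [map_smul, ha A, smul_sub] }
  refine word_induction _ uea_adjoin S (fun A ↦ ?_) (fun n hn y b hb A ↦ ?_) B A
  · obtain ⟨r, hr⟩ := counitMap_eq_smul A
    rw [hT.apply_one, hT.apply_one, hT.apply_one, counitMap_ι_mul,
      counitMap_der _ _ (hT.der x) (hT.ι_ι x), hr, map_smul, der_one _ (hT.der x), smul_zero,
      sub_zero]
  · have hb' := hn hb
    rw [LieHom.coe_toLinearMap, hT.mul', hT.mul', hT.mul', map_mul (comul R L), mulMap_ι_mul,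
      comul_der (T (ι x)) (P.tr x) (hT.der x) (hT.ι_ι x)]
    generalize comul R L A = w
    induction w using TensorProduct.induction_on with
    | zero => simp
    | add u v hu hv =>
      simp only [map_add] at hu hv ⊢
      linear_combination (norm := abel) hu + hv
    | tmul c d =>
      simp only [TensorProduct.map_tmul, mulMap_tmul, map_add, LinearMap.id_apply,
        LinearMap.flip_apply, LinearMap.comp_apply, LinearMap.mulLeft_apply, hT.der, hT.ι_mul]
      rw [hb' d]
      noncomm_ring

theorem unique {T' : U →ₗ[R] U →ₗ[R] U} (hT : IsExtension P T) (hT' : IsExtension P T') :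
    T = T' := by
  have h1 : ∀ x, T (ι x) = T' (ι x) := fun x ↦ LinearMap.ext fun a ↦
    der_ext _ uea_adjoin _ _ (hT.der x) (hT'.der x)
      (fun y ↦ (hT.ι_ι x y).trans (hT'.ι_ι x y).symm) a
  refine LinearMap.ext fun A ↦ word_induction _ uea_adjoin (LinearMap.eqLocus T T') ?_
    (fun n hn x a ha ↦ ?_) A
  · rw [LinearMap.mem_eqLocus]
    exact LinearMap.ext fun b ↦ (hT.one b).trans (hT'.one b).symm
  · rw [LinearMap.mem_eqLocus, LieHom.coe_toLinearMap]
    have e1 : T a = T' a := hn ha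
    have e2 : T (T (ι x) a) = T' (T (ι x) a) :=
      hn (der_mem_wordFiltration _ (T (ι x)) (P.tr x) (hT.der x) (hT.ι_ι x) n a ha)
    refine LinearMap.ext fun b ↦ ?_
    rw [hT.ι_mul_apply, hT'.ι_mul_apply, e2, e1, h1]

end IsExtension

theorem existsUnique_isExtension : ∃! T, IsExtension P T := by
  obtain ⟨T, hT⟩ := exists_isExtension P
  exact ⟨T, hT, fun T' hT' ↦ hT'.unique hT⟩

/-- The unique extension `A ▷ B` of the post-Lie product to the enveloping algebra. -/
def extension : U →ₗ[R] U →ₗ[R] U := (existsUnique_isExtension P).choose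

theorem isExtension_extension : IsExtension P (extension P) :=
  (existsUnique_isExtension P).choose_spec.1

/-- The product `A * B = ∑ A₁ (A₂ ▷ B)`, where `Δ A = ∑ A₁ ⊗ A₂`. -/
def starProduct (A B : U) : U :=
  LinearMap.mul' R U (TensorProduct.map LinearMap.id ((extension P).flip B) (comul R L A))

end Extension
end PostLie

namespace PostLie
section FreeLie
attribute [local instance 100] LieRing.ofAssociativeRing

/-- Pairs `(x, u)` of elements of `L`, with bracket `[(x, u), (y, v)] = ([x, y], [u, y] + [x, v])`;
used only to extend maps on generators of a free Lie algebra to derivations. -/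
structure DualLie (L : Type*) where
  fst : L
  snd : L

namespace DualLie
variable {R L : Type*} [CommRing R] [LieRing L] [LieAlgebra R L]

/-- The underlying pair. -/
def toProd : DualLie L ≃ L × L := ⟨fun x ↦ (x.1, x.2), fun x ↦ ⟨x.1, x.2⟩, fun _ ↦ rfl, fun _ ↦ rfl⟩

instance : AddCommGroup (DualLie L) := toProd.addCommGroup
instance : Module R (DualLie L) := toProd.module R

@[ext] theorem ext' {L : Type*} {x y : DualLie L} (h1 : x.fst = y.fst) (h2 : x.snd = y.snd) : x = y := by
  cases x; cases y; simp_all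

@[simp] theorem add_fst (x y : DualLie L) : (x + y).fst = x.fst + y.fst := rfl
@[simp] theorem add_snd (x y : DualLie L) : (x + y).snd = x.snd + y.snd := rfl
@[simp] theorem zero_fst : (0 : DualLie L).fst = 0 := rfl
@[simp] theorem zero_snd : (0 : DualLie L).snd = 0 := rfl
@[simp] theorem smul_fst (c : R) (x : DualLie L) : (c • x).fst = c • x.fst := rfl
@[simp] theorem smul_snd (c : R) (x : DualLie L) : (c • x).snd = c • x.snd := rfl

instance : Bracket (DualLie L) (DualLie L) :=
  ⟨fun x y ↦ ⟨⁅x.fst, y.fst⁆, ⁅x.snd, y.fst⁆ + ⁅x.fst, y.snd⁆⟩⟩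

@[simp] theorem lie_fst (x y : DualLie L) : ⁅x, y⁆.fst = ⁅x.fst, y.fst⁆ := rfl
@[simp] theorem lie_snd (x y : DualLie L) :
    ⁅x, y⁆.snd = ⁅x.snd, y.fst⁆ + ⁅x.fst, y.snd⁆ := rfl

instance : LieRing (DualLie L) where
  add_lie x y z := by ext <;> simp; abel
  lie_add x y z := by ext <;> simp; abel
  lie_self x := by
    ext
    · simp
    · rw [lie_snd, ← lie_skew, neg_add_cancel]; rfl
  leibniz_lie x y z := by ext <;> simp; abel

instance : LieAlgebra R (DualLie L) where
  lie_smul c x y := by ext <;> simp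

end DualLie

variable {R X : Type*} [CommRing R]

local notation "L" => FreeLieAlgebra R X

theorem freeLie_induction (S : Submodule R L) (h1 : ∀ x, FreeLieAlgebra.of R x ∈ S)
    (h2 : ∀ x ∈ S, ∀ y ∈ S, ⁅x, y⁆ ∈ S) (y : L) : y ∈ S := by
  let K : LieSubalgebra R L := { S with lie_mem' := fun {x y} hx hy ↦ h2 x hx y hy }
  let φ : L →ₗ⁅R⁆ K := FreeLieAlgebra.lift R fun x ↦ (⟨FreeLieAlgebra.of R x, h1 x⟩ : K)
  have : K.incl.comp φ = LieHom.id := by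
    apply FreeLieAlgebra.hom_ext
    intro x
    simp [φ]
  have h := DFunLike.congr_fun this y
  change ((φ y : K) : L) = y at h
  rw [← h]
  exact (φ y).2

theorem freeLie_der (f : X → L) : ∃ D : L →ₗ[R] L, (∀ x, D (FreeLieAlgebra.of R x) = f x) ∧
    ∀ a b, D ⁅a, b⁆ = ⁅D a, b⁆ + ⁅a, D b⁆ := by
  let φ : L →ₗ⁅R⁆ DualLie L := FreeLieAlgebra.lift R fun x ↦ ⟨FreeLieAlgebra.of R x, f x⟩
  have hφ : ∀ a, (φ a).fst = a := fun a ↦ by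
    let S : Submodule R L :=
      { carrier := {a | (φ a).fst = a}
        add_mem' := fun {a b} ha hb ↦ by
          change (φ (a + b)).fst = a + b
          rw [map_add, DualLie.add_fst, ha, hb]
        zero_mem' := by change (φ 0).fst = 0; rw [map_zero]; rfl
        smul_mem' := fun c a ha ↦ by
          change (φ (c • a)).fst = c • a
          rw [map_smul, DualLie.smul_fst, ha] }
    refine freeLie_induction S (fun x ↦ ?_) (fun a ha b hb ↦ ?_) a
    · change (φ _).fst = _
      simp [φ]
    · change (φ _).fst = _
      rw [LieHom.map_lie, DualLie.lie_fst, ha, hb]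
  refine ⟨{ toFun := fun a ↦ (φ a).snd, map_add' := fun a b ↦ ?_, map_smul' := fun c a ↦ ?_ },
    fun x ↦ ?_, fun a b ↦ ?_⟩
  · rw [map_add]; rfl
  · rw [map_smul]; rfl
  · change (φ _).snd = _
    simp [φ]
  · change (φ _).snd = ⁅(φ a).snd, b⁆ + ⁅a, (φ b).snd⁆
    rw [LieHom.map_lie, DualLie.lie_snd, hφ, hφ]

theorem freeLie_der_ext (D D' : L →ₗ[R] L) (hD : ∀ a b, D ⁅a, b⁆ = ⁅D a, b⁆ + ⁅a, D b⁆)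
    (hD' : ∀ a b, D' ⁅a, b⁆ = ⁅D' a, b⁆ + ⁅a, D' b⁆)
    (h : ∀ x, D (FreeLieAlgebra.of R x) = D' (FreeLieAlgebra.of R x)) : D = D' := by
  refine LinearMap.ext fun a ↦ freeLie_induction (LinearMap.eqLocus D D') h (fun a ha b hb ↦ ?_) a
  rw [LinearMap.mem_eqLocus] at *
  rw [hD, hD', ha, hb]

/-- The inclusion of the span of the generators into the free Lie algebra. -/
def genLie : (X →₀ R) →ₗ[R] L := Finsupp.linearCombination R (FreeLieAlgebra.of R)

theorem genLie_single (x : X) : genLie (Finsupp.single x (1 : R)) = FreeLieAlgebra.of R x := by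
  simp [genLie]

/-- The span of the right-nested brackets of at most `n + 1` generators. -/
def lieFiltration (R X : Type*) [CommRing R] : ℕ → Submodule R (FreeLieAlgebra R X)
  | 0 => LinearMap.range genLie
  | n + 1 => lieFiltration R X n ⊔
    Submodule.span R {z | ∃ m : X →₀ R, ∃ y ∈ lieFiltration R X n, z = ⁅genLie m, y⁆}

theorem lieFiltration_mono {m n : ℕ} (h : m ≤ n) :
    lieFiltration R X m ≤ lieFiltration R X n := by
  induction n, h using Nat.le_induction with
  | base => exact le_rfl
  | succ n _ ih => exact ih.trans le_sup_left

theorem lie_mem_lieFiltration (n : ℕ) (m : (X →₀ R)) (y : L) (hy : y ∈ lieFiltration R X n) :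
    ⁅genLie m, y⁆ ∈ (lieFiltration R X (n + 1) : Submodule R L) :=
  Submodule.mem_sup_right (Submodule.subset_span ⟨m, y, hy, rfl⟩)

theorem exists_mem_lieFiltration (y : L) : ∃ n, y ∈ lieFiltration R X n := by
  let V : Submodule R L :=
    { carrier := {y | ∃ n, y ∈ lieFiltration R X n}
      add_mem' := fun {a b} ⟨m, hm⟩ ⟨n, hn⟩ ↦ ⟨max m n, Submodule.add_mem _
        (lieFiltration_mono (le_max_left _ _) hm) (lieFiltration_mono (le_max_right _ _) hn)⟩
      zero_mem' := ⟨0, Submodule.zero_mem _⟩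
      smul_mem' := fun c a ⟨n, hn⟩ ↦ ⟨n, Submodule.smul_mem _ c hn⟩ }
  have hof : ∀ x, FreeLieAlgebra.of R x ∈ V := fun x ↦ ⟨0, _, genLie_single x⟩
  let W : Submodule R L :=
    { carrier := {x | ∀ y ∈ V, ⁅x, y⁆ ∈ V}
      add_mem' := fun {a b} ha hb y hy ↦ by
        rw [add_lie]; exact V.add_mem (ha y hy) (hb y hy)
      zero_mem' := fun y _ ↦ by rw [zero_lie]; exact V.zero_mem
      smul_mem' := fun c a ha y hy ↦ by rw [smul_lie]; exact V.smul_mem c (ha y hy) }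
  have hW : ∀ x, x ∈ W := fun x ↦ by
    refine freeLie_induction W (fun x y ⟨n, hn⟩ ↦ ⟨n + 1, ?_⟩) (fun a ha b hb y hy ↦ ?_) x
    · rw [← genLie_single]
      exact lie_mem_lieFiltration n _ y hn
    · rw [lie_lie]
      exact V.sub_mem (ha _ (hb y hy)) (hb _ (ha y hy))
  exact freeLie_induction V hof (fun a _ b hb ↦ hW a b hb) y

theorem lie_induction (S : Submodule R L) (h0 : ∀ m : X →₀ R, genLie m ∈ S)
    (h1 : ∀ n, lieFiltration R X n ≤ S → ∀ m : X →₀ R, ∀ y ∈ lieFiltration R X n,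
      ⁅genLie m, y⁆ ∈ S) (y : L) : y ∈ S := by
  obtain ⟨n, hn⟩ := exists_mem_lieFiltration y
  suffices ∀ n, lieFiltration R X n ≤ S from this n hn
  intro n
  induction n with
  | zero => rintro _ ⟨m, rfl⟩; exact h0 m
  | succ n ih =>
    refine sup_le ih (Submodule.span_le.2 ?_)
    rintro _ ⟨m, y, hy, rfl⟩
    exact h1 n ih m y hy

theorem der_mem_lieFiltration (D : L →ₗ[R] L) (hD : ∀ a b, D ⁅a, b⁆ = ⁅D a, b⁆ + ⁅a, D b⁆)
    (h : ∀ m, D (genLie m) ∈ LinearMap.range (genLie : (X →₀ R) →ₗ[R] L)) (n : ℕ) :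
    ∀ y ∈ lieFiltration R X n, D y ∈ lieFiltration R X n := by
  induction n with
  | zero => rintro _ ⟨m, rfl⟩; exact h m
  | succ n ih =>
    intro y hy
    refine (sup_le (fun y hy ↦ lieFiltration_mono n.le_succ (ih y hy))
      (Submodule.span_le.2 ?_) : lieFiltration R X (n + 1) ≤ (lieFiltration R X (n + 1)).comap D) hy
    rintro _ ⟨m, y, hy, rfl⟩
    change D _ ∈ lieFiltration R X (n + 1)
    obtain ⟨m', hm'⟩ := h m
    rw [hD, ← hm']
    exact Submodule.add_mem _ (lie_mem_lieFiltration _ _ _ hy) (lie_mem_lieFiltration _ _ _ (ih y hy))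


theorem postLie_mem_range (s : X → X → (X →₀ R)) (P : PostLieProduct R L)
    (hP : ∀ x y, P.tr (FreeLieAlgebra.of R x) (FreeLieAlgebra.of R y) = genLie (s x y)) (y : L) :
    ∀ m, P.tr y (genLie m) ∈ LinearMap.range (genLie : (X →₀ R) →ₗ[R] L) := by
  have h0 : ∀ m m', P.tr (genLie m) (genLie m') ∈ LinearMap.range (genLie : (X →₀ R) →ₗ[R] L) := by
    intro m m'
    induction m using Finsupp.induction_linear with
    | zero => simp
    | add a b ha hb => rw [map_add, map_add]; exact Submodule.add_mem _ ha hb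
    | single x c =>
      induction m' using Finsupp.induction_linear with
      | zero => simp
      | add a b ha hb => rw [map_add, map_add]; exact Submodule.add_mem _ ha hb
      | single y d =>
        refine ⟨(c * d) • s x y, ?_⟩
        rw [map_smul, ← hP]
        simp only [genLie, mul_smul, Finsupp.linearCombination_single, map_smul,
          LinearMap.smul_apply]
        exact smul_comm _ _ _
  let S : Submodule R L :=
    { carrier := {y | ∀ m, P.tr y (genLie m) ∈ LinearMap.range (genLie : (X →₀ R) →ₗ[R] L)}
      add_mem' := fun {a b} ha hb m ↦ by rw [map_add]; exact Submodule.add_mem _ (ha m) (hb m)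
      zero_mem' := fun m ↦ by simp
      smul_mem' := fun c a ha m ↦ by rw [map_smul]; exact Submodule.smul_mem _ c (ha m) }
  refine lie_induction S (fun m m' ↦ h0 m m') (fun n hn m y hy m' ↦ ?_) y
  have h1 := hn (der_mem_lieFiltration _ (P.tr_lie (genLie m)) (h0 m) n y hy) m'
  obtain ⟨a, ha⟩ := hn hy m
  obtain ⟨b, hb⟩ := hn hy m'
  obtain ⟨c, hc⟩ := h0 m m'
  rw [P.lie_tr, ← ha, ← hb, ← hc]
  exact Submodule.sub_mem _ (Submodule.sub_mem _ (h0 _ _) h1)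
    (Submodule.sub_mem _ (hn hy _) (h0 _ _))

theorem postLie_unique (s : X → X → (X →₀ R)) (P P' : PostLieProduct R L)
    (hP : ∀ x y, P.tr (FreeLieAlgebra.of R x) (FreeLieAlgebra.of R y) = genLie (s x y))
    (hP' : ∀ x y, P'.tr (FreeLieAlgebra.of R x) (FreeLieAlgebra.of R y) = genLie (s x y)) :
    P = P' := by
  suffices h : ∀ y, P.tr y = P'.tr y by
    cases P; cases P'
    congr
    exact LinearMap.ext h
  have h0 : ∀ m : (X →₀ R), P.tr (genLie m) = P'.tr (genLie m) := by
    intro m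
    induction m using Finsupp.induction_linear with
    | zero => simp
    | add a b ha hb => rw [map_add, map_add, map_add, ha, hb]
    | single x c =>
      have : genLie (Finsupp.single x c) = c • FreeLieAlgebra.of R x := by simp [genLie]
      rw [this, map_smul, map_smul, freeLie_der_ext _ _ (P.tr_lie _) (P'.tr_lie _)
        fun y ↦ (hP x y).trans (hP' x y).symm]
  intro y
  refine lie_induction (LinearMap.eqLocus P.tr P'.tr) h0 (fun n hn m y hy ↦ ?_) y
  rw [LinearMap.mem_eqLocus]
  have h1 : P.tr y = P'.tr y := hn hy
  have h2 : P.tr (P.tr (genLie m) y) = P'.tr (P.tr (genLie m) y) :=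
    hn (der_mem_lieFiltration _ (P.tr_lie (genLie m)) (postLie_mem_range s P hP (genLie m)) n y hy)
  obtain ⟨a, ha⟩ := postLie_mem_range s P hP y m
  have h3 : P.tr (P.tr y (genLie m)) = P'.tr (P.tr y (genLie m)) := by rw [← ha, h0]
  refine LinearMap.ext fun z ↦ ?_
  rw [P.lie_tr, P'.lie_tr, h2, h3, h0, h1]

theorem postLie_exists (s : X → X → (X →₀ R)) : ∃ P : PostLieProduct R L,
    ∀ x y, P.tr (FreeLieAlgebra.of R x) (FreeLieAlgebra.of R y) = genLie (s x y) := by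
  choose D0 hD01 hD02 using fun x ↦ freeLie_der (fun y ↦ (genLie (s x y) : L))
  let D : (X →₀ R) →ₗ[R] L →ₗ[R] L := Finsupp.linearCombination R D0
  let Sg : (X →₀ R) →ₗ[R] (X →₀ R) →ₗ[R] (X →₀ R) := Finsupp.linearCombination R fun x ↦
    Finsupp.linearCombination R (s x)
  have hD1 : ∀ m m', D m (genLie m') = genLie (Sg m m') := by
    intro m m'
    induction m using Finsupp.induction_linear with
    | zero => simp
    | add a b ha hb =>
      simp only [map_add, LinearMap.add_apply, ha, hb]
    | single x c =>
      induction m' using Finsupp.induction_linear with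
      | zero => simp
      | add a b ha hb => simp only [map_add, ha, hb]
      | single y d =>
        have : (genLie (Finsupp.single y d) : L) = d • FreeLieAlgebra.of R y := by simp [genLie]
        rw [this]
        simp [D, Sg, hD01]
        exact smul_comm _ _ _
  have hD2 : ∀ m a b, D m ⁅a, b⁆ = ⁅D m a, b⁆ + ⁅a, D m b⁆ := by
    intro m a b
    induction m using Finsupp.induction_linear with
    | zero => simp
    | add m m' h h' =>
      simp only [map_add, LinearMap.add_apply, h, h', add_lie, lie_add]; abel
    | single x c => simp [D, hD02]
  obtain ⟨δ, hδ1, hδ2⟩ := tensorAlgebra_der (Sg.compr₂ (TensorAlgebra.ι R : (X →₀ R) →ₗ[R] _))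
  simp only [LinearMap.compr₂_apply] at hδ1
  obtain ⟨T, hT1, hT2⟩ := tensorAlgebra_rec Sg δ hδ1 hδ2 (1 : Module.End R L)
    (LinearMap.mk₂ R (fun x e ↦ (D x).comp e) (fun x y e ↦ by ext; simp)
      (fun c x e ↦ by ext; simp) (fun x e e' ↦ by ext; simp) (fun c x e ↦ by ext; simp))
  simp only [LinearMap.mk₂_apply] at hT2
  let j : (X →₀ R) →ₗ[R] TensorAlgebra R (X →₀ R) := TensorAlgebra.ι R
  let κ : L →ₗ⁅R⁆ TensorAlgebra R (X →₀ R) := FreeLieAlgebra.lift R fun x ↦ j (Finsupp.single x 1)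
  have hκlie : ∀ x y, κ ⁅x, y⁆ = κ x * κ y - κ y * κ x := fun x y ↦ by
    rw [LieHom.map_lie, LieRing.of_associative_ring_bracket]
  have hκ : ∀ m, κ (genLie m) = j m := by
    intro m
    induction m using Finsupp.induction_linear with
    | zero => simp
    | add a b ha hb => simp only [map_add, ha, hb]
    | single x c =>
      have : (genLie (Finsupp.single x c) : L) = c • FreeLieAlgebra.of R x := by simp [genLie]
      rw [this, map_smul]
      simp only [κ, FreeLieAlgebra.lift_of_apply]
      rw [← map_smul]
      simp
  let tr : L →ₗ[R] L →ₗ[R] L := T.comp κ.toLinearMap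
  have htr : ∀ y, tr y = T (κ y) := fun y ↦ rfl
  have htrgen : ∀ m, tr (genLie m) = D m := fun m ↦ by
    have := hT2 m 1
    rw [mul_one, hT1, der_one _ (hδ2 m), map_zero, sub_zero] at this
    rw [htr, hκ]
    exact this
  let fd : L →ₗ[R] (X →₀ R) →ₗ[R] TensorAlgebra R (X →₀ R) :=
    LinearMap.mk₂ R (fun y m ↦ κ (tr y (genLie m))) (fun y z m ↦ by simp) (fun c y m ↦ by simp)
      (fun y m m' ↦ by simp) (fun c y m ↦ by simp)
  have hfd : ∀ y m, fd y m = κ (tr y (genLie m)) := fun _ _ ↦ rfl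
  obtain ⟨d, hd1, hd2⟩ := tensorAlgebra_der fd
  simp only [hfd] at hd1
  have hdgen : ∀ m a, d (genLie m) a = δ m a := fun m a ↦
    der_ext _ TensorAlgebra.adjoin_range_ι _ _ (hd2 _) (hδ2 _)
      (fun m' ↦ by rw [hd1, hδ1, htrgen, hD1, hκ]) a
  have hdκ : ∀ y, (∀ a b, tr y ⁅a, b⁆ = ⁅tr y a, b⁆ + ⁅a, tr y b⁆) →
      ∀ z, d y (κ z) = κ (tr y z) := fun y hy z ↦ by
    refine freeLie_induction (LinearMap.eqLocus ((d y).comp κ.toLinearMap)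
      (κ.toLinearMap.comp (tr y))) (fun x ↦ ?_) (fun a ha b hb ↦ ?_) z
    · change d y (κ _) = κ (tr y _)
      rw [← genLie_single, hκ, hd1]
    · change d y (κ _) = κ (tr y _)
      change d y (κ _) = κ (tr y _) at ha
      change d y (κ _) = κ (tr y _) at hb
      rw [hκlie, map_sub, hd2, hd2, ha, hb, hy, map_add, hκlie, hκlie]
      noncomm_ring
  have hrange : ∀ a m, T a (genLie m) ∈ LinearMap.range (genLie : (X →₀ R) →ₗ[R] L) := by
    intro a
    let S : Submodule R (TensorAlgebra R (X →₀ R)) :=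
      { carrier := {a | ∀ m, T a (genLie m) ∈ LinearMap.range (genLie : (X →₀ R) →ₗ[R] L)}
        add_mem' := fun {a b} ha hb m ↦ by rw [map_add]; exact Submodule.add_mem _ (ha m) (hb m)
        zero_mem' := fun m ↦ by simp
        smul_mem' := fun c a ha m ↦ by rw [map_smul]; exact Submodule.smul_mem _ c (ha m) }
    refine word_induction j TensorAlgebra.adjoin_range_ι S (fun m ↦ ?_) (fun n hn x a ha m ↦ ?_) a
    · rw [hT1]; exact ⟨m, rfl⟩
    · rw [hT2, LinearMap.sub_apply, LinearMap.comp_apply]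
      obtain ⟨m', hm'⟩ := hn ha m
      rw [← hm', hD1]
      exact Submodule.sub_mem _ ⟨_, rfl⟩
        (hn (der_mem_wordFiltration _ (δ x) (Sg x) (hδ2 x) (hδ1 x) n a ha) m)
  let S : Submodule R L :=
    { carrier := {y | (∀ a b, tr y ⁅a, b⁆ = ⁅tr y a, b⁆ + ⁅a, tr y b⁆) ∧
        ∀ A z, T (κ y * A) z = tr y (T A z) - T (d y A) z}
      add_mem' := fun {x y} hx hy ↦ ⟨fun a b ↦ by
          simp only [map_add, LinearMap.add_apply, hx.1, hy.1, add_lie, lie_add]; abel,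
        fun A z ↦ by
          simp only [map_add, add_mul, LinearMap.add_apply, hx.2, hy.2]; abel⟩
      zero_mem' := ⟨fun a b ↦ by simp, fun A z ↦ by simp⟩
      smul_mem' := fun c x hx ↦ ⟨fun a b ↦ by
          simp only [map_smul, LinearMap.smul_apply, hx.1, smul_add, smul_lie, lie_smul],
        fun A z ↦ by
          simp only [map_smul, smul_mul_assoc, LinearMap.smul_apply, hx.2, smul_sub]⟩ }
  have hSgen : ∀ m, genLie m ∈ S := fun m ↦
    ⟨fun a b ↦ by rw [htrgen, hD2], fun A z ↦ by rw [hκ, hT2, htrgen, hdgen]; rfl⟩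
  have hS : ∀ y, y ∈ S := by
    intro y
    refine lie_induction S hSgen (fun n hn m y hy ↦ ?_) y
    have hy1 := (hn hy).1
    have hy2 := (hn hy).2
    have hDy := hn (der_mem_lieFiltration (D m) (hD2 m) (fun m' ↦ ⟨_, (hD1 m m').symm⟩) n y hy)
    obtain ⟨m', hm'⟩ := hrange (κ y) m
    have hyt : tr y (genLie m) ∈ S := by rw [htr, ← hm']; exact hSgen m'
    have hδκ : δ m (κ y) = κ (D m y) := by
      rw [← hdgen, hdκ _ (hSgen m).1, htrgen]
    have e1 : ∀ z, tr ⁅genLie m, y⁆ z =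
        (D m (tr y z) - tr (D m y) z) - (tr y (D m z) - tr (tr y (genLie m)) z) := fun z ↦ by
      rw [htr, hκlie, map_sub, hκ, LinearMap.sub_apply, hT2, LinearMap.sub_apply,
        LinearMap.comp_apply, hδκ, hy2, hd1]
      have : T (j m) = D m := by rw [← htrgen, htr, hκ]
      rw [this]
      rfl
    have e2 : ∀ A, d ⁅genLie m, y⁆ A =
        (δ m (d y A) - d (D m y) A) - (d y (δ m A) - d (tr y (genLie m)) A) := fun A ↦ by
      refine der_ext _ TensorAlgebra.adjoin_range_ι (d ⁅genLie m, y⁆)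
        (((δ m).comp (d y) - d (D m y)) - ((d y).comp (δ m) - d (tr y (genLie m))))
        (hd2 _) (fun a b ↦ ?_) (fun m' ↦ ?_) A
      · simp only [LinearMap.sub_apply, LinearMap.comp_apply, hd2, hδ2, map_add]
        noncomm_ring
      · simp only [LinearMap.sub_apply, LinearMap.comp_apply, hd1, hδ1, e1, map_sub]
        rw [← hdgen, hdκ _ (hSgen m).1, htrgen, hD1]
    refine ⟨fun a b ↦ ?_, fun A z ↦ ?_⟩
    · simp only [e1, hy1, hDy.1, hyt.1, hD2, map_add, sub_lie, lie_sub]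
      abel
    · rw [hκlie, sub_mul, map_sub, LinearMap.sub_apply, hκ, mul_assoc, mul_assoc, hT2,
        LinearMap.sub_apply, LinearMap.comp_apply, hy2, hy2, hδ2, hδκ, hd2, hd1, map_add, map_add,
        LinearMap.add_apply, LinearMap.add_apply, hDy.2, hyt.2, hy2, hT2, hT2, e1, e2]
      simp only [map_sub, LinearMap.sub_apply, LinearMap.comp_apply]
      abel
  refine ⟨⟨tr, fun x y z ↦ (hS x).1 y z, fun x y z ↦ ?_⟩, fun x y ↦ ?_⟩
  · rw [htr ⁅x, y⁆, hκlie, map_sub, LinearMap.sub_apply, (hS x).2, (hS y).2, hdκ x (hS x).1,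
      hdκ y (hS y).1]
    rfl
  · change tr _ _ = _
    rw [← genLie_single, htrgen, ← genLie_single, hD1]
    simp [Sg]

theorem existsUnique_postLie (s : X → X → (X →₀ R)) : ∃! P : PostLieProduct R L,
    ∀ x y, P.tr (FreeLieAlgebra.of R x) (FreeLieAlgebra.of R y) = genLie (s x y) := by
  obtain ⟨P, hP⟩ := postLie_exists s
  exact ⟨P, hP, fun P' hP' ↦ postLie_unique s P' P hP' hP⟩

end FreeLie
end PostLie

/-- Planar rooted trees with vertices labelled by `α`; the children of a vertex are ordered. -/
inductive LabelledTree (α : Type) : Type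
  | node : α → List (LabelledTree α) → LabelledTree α

namespace LabelledTree

variable {α β : Type}

mutual
/-- Apply `f` to all labels of a tree. -/
def map (f : α → β) : LabelledTree α → LabelledTree β
  | node a ts => node (f a) (mapForest f ts)
/-- Apply `f` to all labels of an ordered forest. -/
def mapForest (f : α → β) : List (LabelledTree α) → List (LabelledTree β)
  | [] => []
  | t :: ts => map f t :: mapForest f ts
end

mutual
/-- All trees obtained from a tree by attaching the root of `τ` by a new edge, as leftmost child,
to a vertex whose label satisfies `p`; one entry for each such vertex. -/
def graft (p : α → Bool) (τ : LabelledTree α) : LabelledTree α → List (LabelledTree α)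
  | node a ts =>
    (if p a then [node a (τ :: ts)] else []) ++ (graftForest p τ ts).map (node a)
/-- The same for ordered forests in place of trees. -/
def graftForest (p : α → Bool) (τ : LabelledTree α) :
    List (LabelledTree α) → List (List (LabelledTree α))
  | [] => []
  | t :: ts => (graft p τ t).map (· :: ts) ++ (graftForest p τ ts).map (t :: ·)
end

end LabelledTree

/-- Planar rooted trees. -/
abbrev PlanarTree : Type := LabelledTree Unit

namespace PlanarTree

open LabelledTree

/-- The operation `B⁺`, which joins the trees of an ordered forest to a new root; its inverse `B⁻`
removes the root. -/
def rootEquiv : List PlanarTree ≃ PlanarTree where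
  toFun ω := node () ω
  invFun | node _ ω => ω
  left_inv _ := rfl
  right_inv | node _ _ => rfl

/-- Given the operation `g` of grafting one tree to the vertices labelled `true`, graft
`ω = τ₁ ⋯ τₙ`, first `τₙ`, then `τₙ₋₁` and so on, the vertices of the `τᵢ` being labelled `false`. -/
def graftSuccessively {β : Type} (g : LabelledTree Bool → β → List β) :
    List PlanarTree → β → List β
  | [], b => [b]
  | τ :: ω, b => (graftSuccessively g ω b).flatMap (g (map (fun _ ↦ false) τ))

/-- Left grafting of an ordered forest `ω = τ₁ ⋯ τₙ` to a tree: graft `τₙ` to all vertices, then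
`τₙ₋₁` to all vertices not originally from `τₙ`, and so on. -/
def leftGraft (ω : List PlanarTree) (t : PlanarTree) : List PlanarTree :=
  (graftSuccessively (graft id) ω (map (fun _ ↦ true) t)).map (map fun _ ↦ ())

/-- Left grafting of an ordered forest to an ordered forest. -/
def leftGraftForest (ω ν : List PlanarTree) : List (List PlanarTree) :=
  (graftSuccessively (graftForest id) ω (mapForest (fun _ ↦ true) ν)).map (mapForest fun _ ↦ ())

/-- Both kinds of left grafting agree on a forest that consists of one tree. -/
theorem leftGraftForest_singleton (ω : List PlanarTree) (t : PlanarTree) :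
    leftGraftForest ω [t] = (leftGraft ω t).map ([·]) := by
  have h : ∀ b : LabelledTree Bool, graftSuccessively (graftForest id) ω [b] =
      (graftSuccessively (graft id) ω b).map ([·]) := fun b ↦ by
    induction ω with
    | nil => rfl
    | cons τ ω ih =>
      simp only [graftSuccessively, ih, List.flatMap_map, List.map_flatMap, graftForest,
        List.map_nil, List.append_nil]
  simp only [leftGraftForest, leftGraft, mapForest, h, List.map_map]
  rfl

end PlanarTree

/-- The Lie algebra underlying the free post-Lie algebra on one generator: the free Lie algebra
over the set of planar rooted trees. -/
abbrev FreePostLie (k : Type*) [CommRing k] : Type _ := FreeLieAlgebra k PlanarTree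

/-- The enveloping algebra of the free post-Lie algebra on one generator. -/
abbrev ForestAlgebra (k : Type*) [CommRing k] : Type _ :=
  UniversalEnvelopingAlgebra k (FreePostLie k)

namespace ForestAlgebra

open PlanarTree LabelledTree

variable (k : Type*) [CommRing k]

/-- The sum of a list of trees, in the vector space spanned by the trees. -/
def treeSum (l : List PlanarTree) : PlanarTree →₀ k := (l.map fun t ↦ Finsupp.single t 1).sum

theorem existsUnique_leftGrafting : ∃! P : PostLieProduct k (FreePostLie k),
    ∀ τ σ : PlanarTree, P.tr (FreeLieAlgebra.of k τ) (FreeLieAlgebra.of k σ) =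
      ((graft (fun _ ↦ true) τ σ).map (FreeLieAlgebra.of k)).sum := by
  have h := PostLie.existsUnique_postLie
    fun τ σ : PlanarTree ↦ treeSum k (graft (fun _ ↦ true) τ σ)
  have h' : ∀ l : List PlanarTree, (PostLie.genLie (treeSum k l) : FreePostLie k) =
      (l.map (FreeLieAlgebra.of k)).sum := fun l ↦ by
    simp only [treeSum, map_list_sum, List.map_map]
    congr 2
    exact funext fun t ↦ PostLie.genLie_single t
  simpa only [h'] using h

/-- The post-Lie product of the free post-Lie algebra on one generator: the unique post-Lie product
for which `τ ▷ σ`, for trees `τ` and `σ`, is the sum of all trees that result from attaching the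
root of `τ` to a vertex of `σ` from the left. -/
def leftGrafting : PostLieProduct k (FreePostLie k) := (existsUnique_leftGrafting k).choose

theorem leftGrafting_of (τ σ : PlanarTree) :
    (leftGrafting k).tr (FreeLieAlgebra.of k τ) (FreeLieAlgebra.of k σ) =
      ((graft (fun _ ↦ true) τ σ).map (FreeLieAlgebra.of k)).sum :=
  (existsUnique_leftGrafting k).choose_spec.1 τ σ

/-- The basis of the enveloping algebra that consists of the ordered forests. -/
def forest : Module.Basis (List PlanarTree) k (ForestAlgebra k) :=
  ((FreeAlgebra.basisFreeMonoid k PlanarTree).map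
    (FreeLieAlgebra.universalEnvelopingEquivFreeAlgebra k PlanarTree).symm.toLinearEquiv).reindex
      FreeMonoid.toList

section
attribute [local instance 100] LieRing.ofAssociativeRing

/-- An ordered forest is the product of its trees in the enveloping algebra. -/
theorem forest_apply (ω : List PlanarTree) : forest k ω =
    (ω.map fun τ ↦ UniversalEnvelopingAlgebra.ι k (FreeLieAlgebra.of k τ)).prod := by
  have h : ∀ w : FreeMonoid PlanarTree, FreeAlgebra.basisFreeMonoid k PlanarTree w =
      (w.toList.map (FreeAlgebra.ι k)).prod := fun w ↦ by
    simp [FreeAlgebra.basisFreeMonoid, FreeAlgebra.equivMonoidAlgebraFreeMonoid,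
      FreeMonoid.lift_apply]
  simp only [forest, Module.Basis.reindex_apply, Module.Basis.map_apply, h,
    AlgEquiv.toLinearEquiv_apply, map_list_prod, List.map_map]
  congr 2
  funext τ
  simp only [Function.comp_apply, AlgEquiv.symm_apply_eq]
  simp [-UniversalEnvelopingAlgebra.ι_apply, FreeLieAlgebra.universalEnvelopingEquivFreeAlgebra]
  rw [UniversalEnvelopingAlgebra.lift_ι_apply, FreeLieAlgebra.lift_of_apply]

end

/-- `B⁺`, as a linear isomorphism from the span of the ordered forests to the span of the trees;
the inverse is `B⁻`. -/
def bPlus : ForestAlgebra k ≃ₗ[k] (PlanarTree →₀ k) :=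
  (forest k).repr.trans (Finsupp.domLCongr rootEquiv)

/-- Left grafting of forests to trees, extended bilinearly. -/
def graftLinear : ForestAlgebra k →ₗ[k] (PlanarTree →₀ k) →ₗ[k] (PlanarTree →₀ k) :=
  (forest k).constr k fun ω ↦ Finsupp.linearCombination k fun t ↦ treeSum k (leftGraft ω t)

/-- The planar Grossman–Larson product `A ∘ B = B⁻(A ▷ B⁺(B))`. -/
def grossmanLarson (A B : ForestAlgebra k) : ForestAlgebra k :=
  (bPlus k).symm (graftLinear k A (bPlus k B))

end ForestAlgebra

end

-- Both claims follow from a recursion in the left argument. For a tree `τ`, a forest `ω` and any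
-- `B`, the extended product satisfies `(τω) ▷ B = τ ▷ (ω ▷ B) - (τ ▷ ω) ▷ B`. Since `τ ▷ _` is a
-- derivation, `τ ▷ ω` is the sum of the forests that arise when `τ` is grafted to a vertex of `ω`.
-- These have as many trees as `ω`, so by induction on the number of trees the recursion and the
-- value at the empty forest determine `ω ▷ B` (`forest_induction`).
--
-- Left grafting obeys the same recursion for a combinatorial reason. Graft `ω` to `ν`, then `τ` to
-- any vertex of a result. If that vertex comes from `ν`, the outcome belongs to the left grafting
-- of `τω`. If it comes from `ω`, then `τ` could have been grafted to `ω` beforehand, and the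
-- outcome belongs to the left grafting of some term of `τ ▷ ω`. This is
-- `sum_leftGraftForest_graftForest`. The labels `true` (from `ν`) and `false` (from `ω`) separate
-- the two cases, and `sum_graft_graft` exchanges the two graftings.
--
-- For the star product, the coproduct gives `(τA) * B = τ(A * B) + τ ▷ (A * B) - (τ ▷ A) * B`
-- (`ι_mul_starProduct`). Under `B⁺`, the operator `C ↦ τC + τ ▷ C` becomes the grafting of `τ` to
-- all vertices of a tree: the root accounts for `τC`, the other vertices for `τ ▷ C`. Hence the
-- same combinatorial identity, for the one-tree forest `B⁺(ν)`, shows that the star product of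
-- forests is the Grossman–Larson product. Bilinearity gives the general case.

namespace LabelledTree

-- Sums over lists; relabelling and its effect on grafting.

variable {α β : Type} {M : Type*}

theorem sum_map_flatMap [AddMonoid M] {γ δ : Type*} (l : List γ) (g : γ → List δ) (f : δ → M) :
    ((l.flatMap g).map f).sum = (l.map fun x ↦ ((g x).map f).sum).sum := by
  induction l with
  | nil => simp
  | cons x l ih => simp [ih]

theorem sum_map_comm [AddCommMonoid M] {γ δ : Type*} (l : List γ) (m : List δ) (f : γ → δ → M) :
    (l.map fun x ↦ (m.map fun y ↦ f x y).sum).sum =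
      (m.map fun y ↦ (l.map fun x ↦ f x y).sum).sum := by
  induction l with
  | nil => simp
  | cons x l ih => simp [ih, List.sum_map_add]

mutual
theorem map_map_apply {γ : Type} (g : β → γ) (f : α → β) :
    ∀ t : LabelledTree α, map g (map f t) = map (g ∘ f) t
  | node a ts => by simp [map, mapForest_mapForest g f ts]
theorem mapForest_mapForest {γ : Type} (g : β → γ) (f : α → β) :
    ∀ ts : List (LabelledTree α), mapForest g (mapForest f ts) = mapForest (g ∘ f) ts
  | [] => by simp [mapForest]
  | t :: ts => by simp [mapForest, map_map_apply g f t, mapForest_mapForest g f ts]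
end

mutual
theorem map_id_apply : ∀ t : LabelledTree α, map id t = t
  | node a ts => by simp [map, mapForest_id ts]
theorem mapForest_id : ∀ ts : List (LabelledTree α), mapForest id ts = ts
  | [] => by simp [mapForest]
  | t :: ts => by simp [mapForest, map_id_apply t, mapForest_id ts]
end

mutual
-- Relabelling keeps the shape, so a vertex is admissible for `p` afterwards exactly if it was
-- admissible for `p ∘ g` before. This allows passage between labelled and plain trees.
theorem graft_map (p : β → Bool) (g : α → β) (τ : LabelledTree α) :
    ∀ t, graft p (map g τ) (map g t) = (graft (p ∘ g) τ t).map (map g)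
  | node a ts => by
    have h : (map g ∘ node a) = (node (g a) ∘ mapForest g) := funext fun us ↦ by simp [map]
    by_cases ha : p (g a) <;> simp [map, mapForest, graft, graftForest_mapForest p g τ ts, ha, h]
theorem graftForest_mapForest (p : β → Bool) (g : α → β) (τ : LabelledTree α) :
    ∀ ts, graftForest p (map g τ) (mapForest g ts) = (graftForest (p ∘ g) τ ts).map (mapForest g)
  | [] => by simp [mapForest, graftForest]
  | t :: ts => by
    simp [mapForest, graftForest, graft_map p g τ t, graftForest_mapForest p g τ ts,
      Function.comp_def]
end

mutual
-- No vertex is admissible. This covers both a grafted tree, labelled `false`, which receives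
-- nothing at `true` vertices, and the original forest, labelled `true`, which receives nothing at
-- `false` vertices.
theorem graft_map_false (p : α → Bool) (g : β → α) (hg : ∀ b, p (g b) = false)
    (τ : LabelledTree α) : ∀ t, graft p τ (map g t) = []
  | node a ts => by simp [map, graft, graftForest_mapForest_false p g hg τ ts, hg]
theorem graftForest_mapForest_false (p : α → Bool) (g : β → α) (hg : ∀ b, p (g b) = false)
    (τ : LabelledTree α) : ∀ ts, graftForest p τ (mapForest g ts) = []
  | [] => by simp [mapForest, graftForest]
  | t :: ts => by
    simp [mapForest, graftForest, graft_map_false p g hg τ t,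
      graftForest_mapForest_false p g hg τ ts]
end

-- Splitting the set of vertices and exchanging two graftings.

section Sums

variable [AddCommMonoid M]

mutual
-- Each vertex either satisfies `p` or does not. The two lists together agree with the third only up
-- to order, so the identity is expressed by sums of an arbitrary `f` with values in a commutative
-- monoid, as are the identities below.
theorem sum_graft_add_not (p : α → Bool) (τ : LabelledTree α) :
    ∀ t (f : LabelledTree α → M), ((graft p τ t).map f).sum +
      ((graft (fun a ↦ !p a) τ t).map f).sum = ((graft (fun _ ↦ true) τ t).map f).sum
  | node a ts, f => by
    have h := sum_graftForest_add_not p τ ts (f ∘ node a)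
    cases ha : p a <;> simp [graft, ha, ← h] <;> abel
theorem sum_graftForest_add_not (p : α → Bool) (τ : LabelledTree α) :
    ∀ ts (f : List (LabelledTree α) → M), ((graftForest p τ ts).map f).sum +
      ((graftForest (fun a ↦ !p a) τ ts).map f).sum =
        ((graftForest (fun _ ↦ true) τ ts).map f).sum
  | [], f => by simp [graftForest]
  | t :: ts, f => by
    have h := sum_graftForest_add_not p τ ts (f ∘ (t :: ·))
    have h' := sum_graft_add_not p τ t (f ∘ (· :: ts))
    simp only [graftForest, List.map_append, List.map_map, List.sum_append, ← h, ← h']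
    abel
end

mutual
/-- Grafting `σ` to the vertices in `p` and then `τ` to the vertices in `q`. -/
theorem sum_graft_graft {p q : α → Bool} (hpq : ∀ a, p a = true → q a = false)
    (σ τ : LabelledTree α) (hτ : ∀ σ', graft p σ' τ = []) :
    ∀ t (f : LabelledTree α → M),
      ((graft p σ t).map fun u ↦ ((graft q τ u).map f).sum).sum =
        ((graft q τ t).map fun u ↦ ((graft p σ u).map f).sum).sum +
        ((graft q τ σ).map fun σ' ↦ ((graft p σ' t).map f).sum).sum
  | node a ts, f => by
    have h := sum_graftForest_graftForest hpq σ τ hτ ts (f ∘ node a)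
    -- The root receives nothing, or `τ` only, or `σ` only. In the second case `hτ` prevents `σ`
    -- from being grafted into the new child `τ`; in the third, grafting `τ` into the new child `σ`
    -- yields the correction term. A root open to both is excluded by `hpq`: there the left-to-right
    -- order of the new children would depend on the order of grafting.
    cases ha : p a <;> cases hb : q a
    · simpa [graft, graftForest, ha, hb, Function.comp_def, List.sum_map_add, hτ] using h
    · simp [graft, graftForest, ha, hb, Function.comp_def, List.sum_map_add, hτ] at h ⊢
      rw [h]; abel
    · simp [graft, graftForest, ha, hb, Function.comp_def, List.sum_map_add] at h ⊢
      rw [h]; abel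
    · simp [hpq a ha] at hb
-- If both graftings meet the same part of `t :: ts`, the identity for that part applies; if one
-- meets `t` and the other `ts`, they are independent and the two sums can be interchanged.
theorem sum_graftForest_graftForest {p q : α → Bool} (hpq : ∀ a, p a = true → q a = false)
    (σ τ : LabelledTree α) (hτ : ∀ σ', graft p σ' τ = []) :
    ∀ ts (f : List (LabelledTree α) → M),
      ((graftForest p σ ts).map fun u ↦ ((graftForest q τ u).map f).sum).sum =
        ((graftForest q τ ts).map fun u ↦ ((graftForest p σ u).map f).sum).sum +
        ((graft q τ σ).map fun σ' ↦ ((graftForest p σ' ts).map f).sum).sum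
  | [], f => by simp [graftForest]
  | t :: ts, f => by
    have h := sum_graftForest_graftForest hpq σ τ hτ ts (f ∘ (t :: ·))
    have h' := sum_graft_graft hpq σ τ hτ t (f ∘ (· :: ts))
    simp only [graftForest, List.map_append, List.map_map, List.sum_append, Function.comp_def,
      List.sum_map_add] at h h' ⊢
    rw [h, h', sum_map_comm (graft p σ t), sum_map_comm (graft q τ t)]
    abel
end

end Sums

end LabelledTree

-- The grafting recursion for ordered forests.

namespace PlanarTree

open LabelledTree

/-- A `false` vertex of a result lies in a tree of `ω` or was a `false` vertex of `b`; in either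
case `τ` may be grafted there first. The first tree of `ω` is grafted last, so induction on `ω`
exchanges it with `τ`. The function `f` has to vary, since the induction hypothesis is applied to
the sum over the graftings of that tree. -/
theorem sum_graftSuccessively_graftForest {M : Type*} [AddCommMonoid M] (τ : PlanarTree) :
    ∀ (ω : List PlanarTree) (b : List (LabelledTree Bool)) (f : List (LabelledTree Bool) → M),
      ((graftSuccessively (graftForest id) ω b).map fun u ↦
          ((graftForest (fun c ↦ !c) (map (fun _ ↦ false) τ) u).map f).sum).sum =
        ((graftForest (fun _ ↦ true) τ ω).map fun ω' ↦
          ((graftSuccessively (graftForest id) ω' b).map f).sum).sum +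
        ((graftForest (fun c ↦ !c) (map (fun _ ↦ false) τ) b).map fun u ↦
          ((graftSuccessively (graftForest id) ω u).map f).sum).sum
  | [], b, f => by simp [graftSuccessively, graftForest]
  | σ :: ω, b, f => by
    have hcomm := fun u ↦ sum_graftForest_graftForest (p := id) (q := fun c ↦ !c)
      (by simp) (map (fun _ ↦ false) σ) (map (fun _ ↦ false) τ)
      (fun σ' ↦ graft_map_false _ _ (by simp) _ _) u f
    have ih := sum_graftSuccessively_graftForest τ ω b
      fun u ↦ ((graftForest id (map (fun _ ↦ false) σ) u).map f).sum
    -- All of `σ` is labelled `false`, so grafting to its `false` vertices is unrestricted grafting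
    -- of plain trees.
    have hσ := graft_map (fun c ↦ !c) (fun _ : Unit ↦ false) τ σ
    simp only [graftSuccessively, sum_map_flatMap, hcomm, List.sum_map_add, ih, hσ, graftForest,
      List.map_append, List.map_map, List.sum_append, Function.comp_def, Bool.not_false]
    rw [sum_map_comm]
    abel

/-- Grafting a tree to all vertices of the results of grafting a forest. -/
theorem sum_leftGraftForest_graftForest {M : Type*} [AddCommMonoid M] (τ : PlanarTree)
    (ω ν : List PlanarTree) (f : List PlanarTree → M) :
    ((leftGraftForest ω ν).map fun u ↦ ((graftForest (fun _ ↦ true) τ u).map f).sum).sum =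
      ((leftGraftForest (τ :: ω) ν).map f).sum +
      ((graftForest (fun _ ↦ true) τ ω).map fun ω' ↦ ((leftGraftForest ω' ν).map f).sum).sum := by
  have hτ : map (fun _ : Bool ↦ ()) (map (fun _ : Unit ↦ false) τ) = τ :=
    (map_map_apply _ _ τ).trans (map_id_apply τ)
  have h1 := sum_graftSuccessively_graftForest τ ω (mapForest (fun _ ↦ true) ν)
    (f ∘ mapForest fun _ ↦ ())
  -- All vertices of `ν` are labelled `true`, so the term with `τ` grafted to `false` vertices of
  -- the original forest vanishes.
  rw [graftForest_mapForest_false _ _ (by simp)] at h1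
  -- Split by origin: the `true` vertices give the left grafting of `τ :: ω`, the `false` ones are
  -- handled by `h1`.
  have h2 := fun u ↦ sum_graftForest_add_not (id : Bool → Bool) (map (fun _ ↦ false) τ) u
    (f ∘ mapForest fun _ ↦ ())
  -- Grafting to all vertices does not see the labels, so they may be forgotten before or after it.
  have h3 := fun u ↦ graftForest_mapForest (fun _ ↦ true) (fun _ : Bool ↦ ())
    (map (fun _ : Unit ↦ false) τ) u
  simp only [hτ, Function.comp_def] at h3
  simp only [leftGraftForest, graftSuccessively, List.map_map, Function.comp_def, h3,
    sum_map_flatMap, id_eq] at h1 h2 ⊢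
  simp only [← h2, List.sum_map_add, h1]
  simp

/-- Grafting to a vertex enlarges a tree without adding one; this is what makes induction on the
number of trees possible. -/
theorem length_of_mem_graftForest {α : Type} (p : α → Bool) (τ : LabelledTree α) :
    ∀ ω, ∀ ω' ∈ graftForest p τ ω, ω'.length = ω.length
  | [], ω', h => by simp [graftForest] at h
  | t :: ω, ω', h => by
    simp only [graftForest, List.mem_append, List.mem_map] at h
    obtain ⟨t', _, rfl⟩ | ⟨ν, hν, rfl⟩ := h
    · simp
    · simp [length_of_mem_graftForest p τ ω ν hν]

theorem leftGraftForest_nil (ν : List PlanarTree) : leftGraftForest [] ν = [ν] := by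
  have h : mapForest (fun _ : Bool ↦ ()) (mapForest (fun _ : Unit ↦ true) ν) = ν :=
    (mapForest_mapForest _ _ ν).trans (mapForest_id ν)
  simp [leftGraftForest, graftSuccessively, h]

end PlanarTree

-- The recursion for the star product in an enveloping algebra.

namespace PostLie

attribute [local instance 100] LieRing.ofAssociativeRing

variable {R L : Type*} [CommRing R] [LieRing L] [LieAlgebra R L] (P : PostLieProduct R L)

theorem starProduct_eq_mulMap (A B : UniversalEnvelopingAlgebra R L) :
    starProduct P A B = mulMap LinearMap.id ((extension P).flip B) (comul R L A) := rfl

theorem one_starProduct (B : UniversalEnvelopingAlgebra R L) : starProduct P 1 B = B := by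
  rw [starProduct_eq_mulMap, map_one (comul R L), Algebra.TensorProduct.one_def, mulMap_tmul]
  simp [(isExtension_extension P).one]

/-- The product `(x A) * B` for `x` in the Lie algebra. -/
theorem ι_mul_starProduct (x : L) (A B : UniversalEnvelopingAlgebra R L) :
    starProduct P (UniversalEnvelopingAlgebra.ι R x * A) B =
      UniversalEnvelopingAlgebra.ι R x * starProduct P A B +
        extension P (UniversalEnvelopingAlgebra.ι R x) (starProduct P A B) -
        starProduct P (extension P (UniversalEnvelopingAlgebra.ι R x) A) B := by
  have hT := isExtension_extension P
  simp only [starProduct_eq_mulMap]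
  -- The coproduct of `x A` is `(x ⊗ 1 + 1 ⊗ x) Δ(A)`, and `x ▷ _` is a coderivation. Both sides
  -- become linear in `Δ(A)`, which may then be replaced by a pure tensor `c ⊗ d`. There the two
  -- terms `(x ▷ c)(d ▷ B)` cancel.
  rw [map_mul (comul R L), mulMap_ι_mul,
    comul_der (extension P (UniversalEnvelopingAlgebra.ι R x)) (P.tr x) (hT.der x) (hT.ι_ι x)]
  generalize comul R L A = w
  induction w using TensorProduct.induction_on with
  | zero => simp
  | add u v hu hv =>
    simp only [map_add, mul_add] at hu hv ⊢
    linear_combination (norm := abel) hu + hv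
  | tmul c d =>
    simp only [TensorProduct.map_tmul, mulMap_tmul, map_add, LinearMap.id_apply,
      LinearMap.flip_apply, LinearMap.comp_apply, LinearMap.mulLeft_apply, hT.der,
      hT.ι_mul_apply]
    noncomm_ring

end PostLie

-- Products of ordered forests in the enveloping algebra.

namespace ForestAlgebra

open PlanarTree LabelledTree

variable (k : Type*) [CommRing k]

section
attribute [local instance 100] LieRing.ofAssociativeRing

theorem forest_nil : forest k [] = 1 := by simp [forest_apply]

theorem forest_cons (τ : PlanarTree) (ω : List PlanarTree) : forest k (τ :: ω) =
    UniversalEnvelopingAlgebra.ι k (FreeLieAlgebra.of k τ) * forest k ω := by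
  simp only [forest_apply, List.map_cons, List.prod_cons]

/-- The extended product of a tree and a forest. -/
theorem extension_tree_forest (τ : PlanarTree) (ν : List PlanarTree) :
    PostLie.extension (leftGrafting k) (UniversalEnvelopingAlgebra.ι k (FreeLieAlgebra.of k τ))
        (forest k ν) =
      ((graftForest (fun _ ↦ true) τ ν).map (forest k)).sum := by
  have hT := PostLie.isExtension_extension (leftGrafting k)
  induction ν with
  | nil => rw [forest_nil, PostLie.der_one _ (hT.der _)]; simp [graftForest]
  | cons t ν ih =>
    -- The Leibniz rule mirrors the choice of a vertex in the first tree or in the remaining ones.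
    rw [forest_cons, hT.der, hT.ι_ι, leftGrafting_of, ih, map_list_sum,
      ← List.sum_map_mul_right, ← List.sum_map_mul_left]
    simp only [graftForest, List.map_append, List.sum_append, List.map_map, Function.comp_def,
      forest_cons]

/-- A function on forests that satisfies the recursion of the extended product in its left
argument is determined by its value at the empty forest. -/
theorem forest_induction {E : Type*} [AddCommGroup E] [Module k E]
    (l : PlanarTree → E → E) (F : ForestAlgebra k →ₗ[k] E) (G : List PlanarTree → E)
    (h0 : F 1 = G [])
    (hF : ∀ τ a, F (UniversalEnvelopingAlgebra.ι k (FreeLieAlgebra.of k τ) * a) = l τ (F a) -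
      F (PostLie.extension (leftGrafting k)
        (UniversalEnvelopingAlgebra.ι k (FreeLieAlgebra.of k τ)) a))
    (hG : ∀ τ ω, l τ (G ω) = G (τ :: ω) + ((graftForest (fun _ ↦ true) τ ω).map G).sum)
    (ω : List PlanarTree) : F (forest k ω) = G ω := by
  -- Structural induction would not suffice: the recursion for `τ :: ω` also uses the forests
  -- obtained by grafting `τ` to `ω`, which have the length of `ω` but different trees.
  induction hn : ω.length generalizing ω with
  | zero => rw [List.length_eq_zero_iff.1 hn, forest_nil, h0]
  | succ n ih =>
    obtain ⟨τ, ω, rfl⟩ := List.exists_cons_of_length_eq_add_one hn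
    rw [List.length_cons, Nat.add_right_cancel_iff] at hn
    rw [forest_cons, hF, ih ω hn, hG, extension_tree_forest, map_list_sum, List.map_map,
      List.map_congr_left (f := F ∘ forest k) (g := G) fun ω' h ↦
        ih ω' ((length_of_mem_graftForest _ _ _ _ h).trans hn)]
    abel

/-- Both sides satisfy the recursion of `forest_induction`, with `τ ▷ _` as the operator `l τ`. -/
theorem extension_forest (ω ν : List PlanarTree) :
    PostLie.extension (leftGrafting k) (forest k ω) (forest k ν) =
      ((leftGraftForest ω ν).map (forest k)).sum := by
  have hT := PostLie.isExtension_extension (leftGrafting k)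
  refine forest_induction k (fun τ ↦ PostLie.extension (leftGrafting k)
      (UniversalEnvelopingAlgebra.ι k (FreeLieAlgebra.of k τ)))
    ((PostLie.extension (leftGrafting k)).flip (forest k ν))
    (fun ω ↦ ((leftGraftForest ω ν).map (forest k)).sum) ?_ (fun τ a ↦ ?_) (fun τ ω ↦ ?_) ω
  · simp [hT.one, leftGraftForest_nil]
  · simp only [LinearMap.flip_apply, hT.ι_mul_apply]
  · rw [map_list_sum, List.map_map, ← sum_leftGraftForest_graftForest]
    simp only [Function.comp_def, extension_tree_forest]

/-- The star product of forests, by grafting to a new root and removing this root. -/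
theorem starProduct_forest (ω ν : List PlanarTree) :
    PostLie.starProduct (leftGrafting k) (forest k ω) (forest k ν) =
      ((leftGraft ω (rootEquiv ν)).map fun t ↦ forest k (rootEquiv.symm t)).sum := by
  -- This operator corresponds under `B⁺` to grafting `τ` to every vertex of a tree, the root
  -- included.
  let l : PlanarTree → ForestAlgebra k → ForestAlgebra k := fun τ A ↦
    UniversalEnvelopingAlgebra.ι k (FreeLieAlgebra.of k τ) * A +
      PostLie.extension (leftGrafting k)
        (UniversalEnvelopingAlgebra.ι k (FreeLieAlgebra.of k τ)) A
  refine forest_induction k l ((PostLie.mulMap LinearMap.id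
      ((PostLie.extension (leftGrafting k)).flip (forest k ν))).comp
        (PostLie.comul k (FreePostLie k)).toLinearMap)
    (fun ω ↦ ((leftGraft ω (rootEquiv ν)).map fun t ↦ forest k (rootEquiv.symm t)).sum)
    ?_ (fun τ a ↦ ?_) (fun τ ω ↦ ?_) ω
  · refine (PostLie.one_starProduct _ _).trans ?_
    have h := leftGraftForest_singleton [] (rootEquiv ν)
    rw [leftGraftForest_nil] at h
    cases hl : leftGraft [] (rootEquiv ν) with
    | nil => simp [hl] at h
    | cons t ts =>
      simp only [hl, List.map_cons, List.cons.injEq, List.nil_eq, List.map_eq_nil_iff,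
        and_true] at h
      simp [h.2, ← h.1]
  · exact PostLie.ι_mul_starProduct _ _ _ _
  -- The tree `B⁺(ν)` is treated as a one-tree forest. The function has to be defined on all
  -- forests; the sum over the trees is a choice that reduces to `B⁻` on a single tree.
  · have h := sum_leftGraftForest_graftForest τ ω [rootEquiv ν]
      fun u ↦ (u.map fun t ↦ forest k (rootEquiv.symm t)).sum
    simp only [leftGraftForest_singleton, List.map_map, Function.comp_def, graftForest,
      List.append_nil, List.map_nil, List.map_cons, List.sum_cons, List.sum_nil, add_zero] at h
    rw [← h]
    -- Grafting to the root puts `τ` in front of the forest below it, which is left multiplication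
    -- by `τ`; grafting elsewhere is `τ ▷ _` on this forest.
    have hl : ∀ t : PlanarTree, l τ (forest k (rootEquiv.symm t)) =
        ((graft (fun _ ↦ true) τ t).map fun t ↦ forest k (rootEquiv.symm t)).sum := by
      rintro ⟨_, ts⟩
      simp only [l, graft, if_true, List.map_append, List.sum_append, List.map_map,
        Function.comp_def]
      simp [-UniversalEnvelopingAlgebra.ι_apply, rootEquiv, forest_cons, extension_tree_forest]
    simp only [← hl]
    -- What remains is the additivity of `l τ` over an arbitrary list.
    generalize leftGraft ω (rootEquiv ν) = ts
    induction ts with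
    | nil => simp [l]
    | cons t ts ih =>
      simp only [List.map_cons, List.sum_cons, ← ih, l, mul_add, map_add]
      abel

end

-- Comparison with the Grossman–Larson product.

theorem bPlus_forest (ω : List PlanarTree) :
    bPlus k (forest k ω) = Finsupp.single (rootEquiv ω) 1 := by
  simp [bPlus]

theorem grossmanLarson_forest (ω ν : List PlanarTree) :
    grossmanLarson k (forest k ω) (forest k ν) =
      ((leftGraft ω (rootEquiv ν)).map fun t ↦ forest k (rootEquiv.symm t)).sum := by
  have h : ∀ t, (bPlus k).symm (Finsupp.single t 1) = forest k (rootEquiv.symm t) := fun t ↦ by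
    rw [LinearEquiv.symm_apply_eq, bPlus_forest, Equiv.apply_symm_apply]
  rw [grossmanLarson, bPlus_forest, graftLinear, Module.Basis.constr_basis,
    Finsupp.linearCombination_single, one_smul, treeSum, map_list_sum, List.map_map]
  simp only [Function.comp_def, h]

/-- Both products are bilinear and the ordered forests form a basis, on which `starProduct_forest`
and `grossmanLarson_forest` give the same sum. -/
theorem starProduct_eq_grossmanLarson (A B : ForestAlgebra k) :
    PostLie.starProduct (leftGrafting k) A B = grossmanLarson k A B := by
  let S : ForestAlgebra k →ₗ[k] ForestAlgebra k →ₗ[k] ForestAlgebra k :=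
    LinearMap.mk₂ k (PostLie.starProduct (leftGrafting k))
      (fun A A' B ↦ by simp only [PostLie.starProduct, map_add])
      (fun c A B ↦ by simp only [PostLie.starProduct, map_smul])
      (fun A B B' ↦ by
        simp only [PostLie.starProduct, map_add, TensorProduct.map_add_right, LinearMap.add_apply])
      (fun c A B ↦ by
        simp only [PostLie.starProduct, map_smul, TensorProduct.map_smul_right,
          LinearMap.smul_apply])
  let G : ForestAlgebra k →ₗ[k] ForestAlgebra k →ₗ[k] ForestAlgebra k :=
    ((graftLinear k).compl₂ (bPlus k).toLinearMap).compr₂ (bPlus k).symm.toLinearMap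
  have h : S = G := (forest k).ext fun ω ↦ (forest k).ext fun ν ↦
    (starProduct_forest k ω ν).trans (grossmanLarson_forest k ω ν).symm
  exact LinearMap.congr_fun₂ h A B

end ForestAlgebra

theorem mainTheorem5 (k : Type*) [Field k] [CharZero k] :
    (∀ ω ν : List PlanarTree,
      PostLie.extension (ForestAlgebra.leftGrafting k) (ForestAlgebra.forest k ω)
          (ForestAlgebra.forest k ν) =
        ((PlanarTree.leftGraftForest ω ν).map (ForestAlgebra.forest k)).sum) ∧
    ∀ A B : ForestAlgebra k,
      PostLie.starProduct (ForestAlgebra.leftGrafting k) A B =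
        ForestAlgebra.grossmanLarson k A B :=
  ⟨ForestAlgebra.extension_forest k, ForestAlgebra.starProduct_eq_grossmanLarson k⟩
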